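/- Let $R$ be a commutative ring with unit such that $R=2R$ (i.e. $2$ is a unit of $R$), and let $I$ be an ideal of $R$. Let $(P,\langle\,,\rangle)$ be an orthogonal $R$-module, i.e. a finitely generated projective $R$-module with a symmetric bilinear form such that the induced map $P\to P^*$ is an isomorphism. Suppose that $P$ has constant rank $2n$ with $n\ge 2$, and that $P$ is locally split: for every maximal ideal $\mathfrak m$ of $R$, the module $P_{\mathfrak m}$ has a direct summand $N$ that is equal to its own orthogonal complement $N^\perp$. For an $R$-algebra $A$ put $P_A=A\otimes_R P$, with the form extended $A$-bilinearly, and $Q_A=A^2\oplus P_A$ with the form $\langle(a,b,p),(a',b',p')\rangle=ab'+ba'+\langle p,p'\rangle$, i.e. the form of $\mathbb H(A)\oplus P_A$. An orthogonal transvection of $Q_A$ is an automorphism $x\mapsto x-\langle u,x\rangle v+\langle v,x\rangle u$, where $u,v\in Q_A$ satisfy $\langle u,u\rangle=\langle v,v\rangle=\langle u,v\rangle=0$ and $u$ or $v$ is unimodular (some $A$-linear functional on $Q_A$ takes the value $1$ at it). An elementary orthogonal transvection of $Q_A$ is an orthogonal transvection of $Q_A$ of one of the forms $$(a,b,p)\mapsto(a,\;b+\langle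 p,q\rangle,\;p-aq),\qquad (a,b,p)\mapsto(a+\langle p,q\rangle,\;b,\;p-bq)$$ with $q\in P_A$ (so necessarily $\langle q,q\rangle=0$); it is called relative to $I$ if $q\in IP_A$. Let $\mathrm{ETrans}_{\mathrm O}(Q_A)$ be the group generated by all elementary orthogonal transvections of $Q_A$, and let $\mathrm{ETrans}_{\mathrm O}(Q_A,IQ_A)$ be the normal closure in $\mathrm{ETrans}_{\mathrm O}(Q_A)$ of the subgroup generated by those relative to $I$. Write $Q[X]=Q_{R[X]}$ and $Q_{\mathfrak m}[X]=Q_{R_{\mathfrak m}[X]}$. Let $\alpha(X)$ be an isometry of $Q[X]$, that is $\alpha(X)\in \mathrm O(Q[X])$, with $\alpha(0)=\mathrm{Id}$. If for every maximal ideal $\mathfrak m$ of $R$ the localization $\alpha(X)_{\mathfrak m}$, an automorphism of $Q_{\mathfrak m}[X]$, lies in $\mathrm{ETrans}_{\mathrm O}(Q_{\mathfrak m}[X],IQ_{\mathfrak m}[X])$, then $\alpha(X)\in\mathrm{ETrans}_{\mathrm O}(Q[X],IQ[X])$. -/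

import Mathlib

open scoped TensorProduct Polynomial

noncomputable section

namespace OrthTrans

section Forms

variable {A : Type*} [CommRing A] {M : Type*} [AddCommGroup M] [Module A M]

/-- An orthogonal module: a finitely generated projective module of even rank with a symmetric
bilinear form which is non-degenerate, i.e. the induced map `M → M*` is an isomorphism. -/
structure IsOrthogonalModule (B : LinearMap.BilinForm A M) : Prop where
  finite : Module.Finite A M
  projective : Module.Projective A M
  even_rank : ∀ p : PrimeSpectrum A, Even (Module.rankAtStalk (R := A) M p)
  symm : ∀ x y : M, B x y = B y x
  nondegenerate : Function.Bijective (fun x : M => (B x : M →ₗ[A] A))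

/-- The module is split: some direct summand `N` equals its own orthogonal complement. -/
def IsSplit (B : LinearMap.BilinForm A M) : Prop :=
  ∃ N : Submodule A M, (∃ N' : Submodule A M, IsCompl N N') ∧
    ∀ x : M, x ∈ N ↔ ∀ y ∈ N, B x y = 0

/-- The module is locally split: its localization at every maximal ideal is split. -/
def IsLocallySplit (B : LinearMap.BilinForm A M) : Prop :=
  ∀ (m : Ideal A) [m.IsMaximal], IsSplit (B.baseChange (Localization.AtPrime m))

/-- The group of isometries `O(M)`, inside the group of linear automorphisms of `M`. -/
def orthogonalGroup (B : LinearMap.BilinForm A M) : Subgroup (M ≃ₗ[A] M) where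
  carrier := {g | ∀ x y, B (g x) (g y) = B x y}
  one_mem' := fun _ _ => rfl
  mul_mem' := fun {g h} hg hh x y => (hg (h x) (h y)).trans (hh x y)
  inv_mem' := fun {g} hg x y => by
    have h := hg (g.symm x) (g.symm y)
    rw [g.apply_symm_apply, g.apply_symm_apply] at h
    exact h.symm

/-- An element `u` is unimodular if some linear functional takes the value `1` at `u`. -/
def IsUnimodular (u : M) : Prop := ∃ f : M →ₗ[A] A, f u = 1

/-- Orthogonal transvections `x ↦ x - ⟨u, x⟩ v + ⟨v, x⟩ u`, where `u`, `v` are isotropic and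
orthogonal to each other, and at least one of them is unimodular. -/
def IsOrthogonalTransvection (B : LinearMap.BilinForm A M) (t : M ≃ₗ[A] M) : Prop :=
  ∃ u v : M, B u u = 0 ∧ B v v = 0 ∧ B u v = 0 ∧
    (IsUnimodular (A := A) u ∨ IsUnimodular (A := A) v) ∧
    ∀ x, t x = x - B u x • v + B v x • u

/-- The form `⟨(a, b, p), (a', b', p')⟩ = a b' + b a' + ⟨p, p'⟩` on `A² ⊕ M`, i.e. on the
orthogonal sum of the hyperbolic plane (with `A* = A`) and `M`. -/
def hypSum (B : LinearMap.BilinForm A M) : LinearMap.BilinForm A (A × A × M) :=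
  LinearMap.mk₂ A (fun x y => x.1 * y.2.1 + x.2.1 * y.1 + B x.2.2 y.2.2)
    (fun x x' y => by simp only [Prod.fst_add, Prod.snd_add, map_add, LinearMap.add_apply]; ring)
    (fun c x y => by
      simp only [Prod.smul_fst, Prod.smul_snd, map_smul, LinearMap.smul_apply, smul_eq_mul]; ring)
    (fun x y y' => by simp only [Prod.fst_add, Prod.snd_add, map_add]; ring)
    (fun c x y => by
      simp only [Prod.smul_fst, Prod.smul_snd, map_smul, smul_eq_mul]; ring)

/-- The elementary orthogonal transvections of `A² ⊕ M` relative to the ideal `J`: those orthogonal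
transvections of `A² ⊕ M` which are of the form `(a, b, p) ↦ (a, b + ⟨p, q⟩, p - a q)` or
`(a, b, p) ↦ (a + ⟨p, q⟩, b, p - b q)` with `q ∈ J M`. -/
def elementaryTransvections (J : Ideal A) (B : LinearMap.BilinForm A M) :
    Set ((A × A × M) ≃ₗ[A] (A × A × M)) :=
  {t | IsOrthogonalTransvection (hypSum B) t ∧ ∃ q ∈ J • (⊤ : Submodule A M),
    (∀ (a b : A) (p : M), t (a, b, p) = (a, b + B p q, p - a • q)) ∨
    (∀ (a b : A) (p : M), t (a, b, p) = (a + B p q, b, p - b • q))}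

/-- The absolute group `ETrans_O(A² ⊕ M)`. -/
def ETrans (B : LinearMap.BilinForm A M) : Subgroup ((A × A × M) ≃ₗ[A] (A × A × M)) :=
  Subgroup.closure (elementaryTransvections ⊤ B)

/-- The group `ETrans_O(J(A² ⊕ M))` generated by relative elementary transvections. -/
def ETransIdeal (J : Ideal A) (B : LinearMap.BilinForm A M) :
    Subgroup ((A × A × M) ≃ₗ[A] (A × A × M)) :=
  Subgroup.closure (elementaryTransvections J B)

/-- The relative group `ETrans_O(A² ⊕ M, J(A² ⊕ M))`: the normal closure of `ETransIdeal J B` in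
`ETrans B`, regarded as a group of automorphisms of `A² ⊕ M`. -/
def ETransRel (J : Ideal A) (B : LinearMap.BilinForm A M) :
    Subgroup ((A × A × M) ≃ₗ[A] (A × A × M)) :=
  (Subgroup.normalClosure
    (((ETransIdeal J B).subgroupOf (ETrans B) : Subgroup (ETrans B)) : Set (ETrans B))).map
    (ETrans B).subtype

end Forms

section BaseChange

variable {R : Type*} [CommRing R] {P : Type*} [AddCommGroup P] [Module R P]

/-- `Q_A = A² ⊕ (A ⊗ P)` for an `R`-algebra `A`. For `A = R[X]` this is `Q[X]`, and for
`A = R_m[X]` it is `Q_m[X]`. -/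
abbrev QMod (A P : Type*) [CommRing A] [Algebra R A] [AddCommGroup P] [Module R P] : Type _ :=
  A × A × (A ⊗[R] P)

variable {A : Type*} [CommRing A] [Algebra R A] {C : Type*} [CommRing C] [Algebra R C]

/-- The natural map `Q_A → Q_C` induced by a homomorphism `A → C` of `R`-algebras. -/
def QMod.map (φ : A →ₐ[R] C) : QMod (R := R) A P →ₗ[R] QMod (R := R) C P :=
  φ.toLinearMap.prodMap (φ.toLinearMap.prodMap (TensorProduct.map φ.toLinearMap LinearMap.id))

lemma QMod.map_smul (φ : A →ₐ[R] C) (a : A) (x : QMod (R := R) A P) :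
    QMod.map φ (a • x) = φ a • QMod.map φ x := by
  obtain ⟨x, y, z⟩ := x
  have hz : TensorProduct.map φ.toLinearMap LinearMap.id (a • z) =
      φ a • TensorProduct.map φ.toLinearMap (LinearMap.id : P →ₗ[R] P) z := by
    induction z with
    | zero => simp
    | tmul b p => simp [TensorProduct.smul_tmul']
    | add u v hu hv => simp only [smul_add, _root_.map_add, hu, hv]
  ext <;> simp [QMod.map, hz]

/-- The extension of scalars along `φ : A → C` of a linear endomorphism of `Q_A`: the `C`-linear
endomorphism of `Q_C` whose values on the standard generators `(1, 0, 0)`, `(0, 1, 0)` and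
`(0, 0, 1 ⊗ p)` are the images of the values of `f`. -/
def extendEnd (φ : A →ₐ[R] C) (f : QMod (R := R) A P →ₗ[A] QMod (R := R) A P) :
    QMod (R := R) C P →ₗ[C] QMod (R := R) C P :=
  (LinearMap.toSpanSingleton C _ (QMod.map φ (f (1, 0, 0)))).coprod
    ((LinearMap.toSpanSingleton C _ (QMod.map φ (f (0, 1, 0)))).coprod
      (LinearMap.liftBaseChange C
        ((QMod.map φ) ∘ₗ (f.restrictScalars R) ∘ₗ (LinearMap.inr R A (A × (A ⊗[R] P))) ∘ₗ
          (LinearMap.inr R A (A ⊗[R] P)) ∘ₗ (TensorProduct.mk R A P 1))))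

/-- The extension of `f` is compatible with `f` under `Q_A → Q_C`. -/
lemma extendEnd_map (φ : A →ₐ[R] C) (f : QMod (R := R) A P →ₗ[A] QMod (R := R) A P)
    (x : QMod (R := R) A P) : extendEnd φ f (QMod.map φ x) = QMod.map φ (f x) := by
  obtain ⟨a, b, z⟩ := x
  have hz : extendEnd φ f (QMod.map φ (0, 0, z)) = QMod.map φ (f (0, 0, z)) := by
    induction z with
    | zero =>
      have : ((0, 0, 0) : QMod (R := R) A P) = 0 := rfl
      simp [this]
    | tmul c p =>
      have : ((0, 0, c ⊗ₜ[R] p) : QMod (R := R) A P) = c • (0, 0, (1 : A) ⊗ₜ[R] p) := by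
        simp [TensorProduct.smul_tmul']
      rw [this, map_smul f, QMod.map_smul, QMod.map_smul, map_smul (extendEnd φ f)]
      simp [extendEnd, QMod.map]
    | add u v hu hv =>
      have : ((0, 0, u + v) : QMod (R := R) A P) = (0, 0, u) + (0, 0, v) := by simp
      rw [this, map_add (QMod.map φ), map_add (extendEnd φ f), hu, hv, map_add f,
        map_add (QMod.map φ)]
  have e : ((a, b, z) : QMod (R := R) A P) =
      a • ((1, 0, 0) : QMod (R := R) A P) + (b • ((0, 1, 0) : QMod (R := R) A P) + (0, 0, z)) := by
    simp
  rw [e]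
  simp only [_root_.map_add, QMod.map_smul, _root_.map_smul, hz]
  congr 1
  · simp [extendEnd, QMod.map]
  · simp [extendEnd, QMod.map]

/-- A `C`-linear map on `Q_C` is determined by its values on the image of `Q_A`. -/
lemma QMod.hom_ext (φ : A →ₐ[R] C) {g h : QMod (R := R) C P →ₗ[C] QMod (R := R) C P}
    (H : ∀ x, g (QMod.map φ x) = h (QMod.map φ x)) : g = h := by
  ext1
  · ext1
    simpa [QMod.map, Prod.mk_zero_zero] using H (1, 0, 0)
  · ext1
    · ext1
      simpa [QMod.map] using H (0, 1, 0)
    · refine TensorProduct.AlgebraTensorModule.curry_injective ?_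
      ext1
      ext1 p
      simpa [QMod.map] using H (0, 0, 1 ⊗ₜ p)

lemma extendEnd_id (φ : A →ₐ[R] C) :
    extendEnd (P := P) φ LinearMap.id = LinearMap.id :=
  QMod.hom_ext φ fun x => by rw [extendEnd_map]; rfl

lemma extendEnd_comp (φ : A →ₐ[R] C) (f g : QMod (R := R) A P →ₗ[A] QMod (R := R) A P) :
    extendEnd φ (f ∘ₗ g) = extendEnd φ f ∘ₗ extendEnd φ g :=
  QMod.hom_ext φ fun x => by
    rw [extendEnd_map, LinearMap.comp_apply, LinearMap.comp_apply, extendEnd_map, extendEnd_map]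

/-- The extension of scalars along `φ : A → C` of a linear automorphism of `Q_A`. -/
def extendAut (φ : A →ₐ[R] C) (f : QMod (R := R) A P ≃ₗ[A] QMod (R := R) A P) :
    QMod (R := R) C P ≃ₗ[C] QMod (R := R) C P :=
  LinearEquiv.ofLinearMap (extendEnd φ f.toLinearMap) (extendEnd φ f.symm.toLinearMap)
    (by rw [← extendEnd_comp, LinearEquiv.comp_symm, extendEnd_id])
    (by rw [← extendEnd_comp, LinearEquiv.symm_comp, extendEnd_id])

/-- `α(0)`: the specialization at `X = 0` of an automorphism `α(X)` of `Q[X]`. -/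
def evalZero (α : QMod (R := R) R[X] P ≃ₗ[R[X]] QMod (R := R) R[X] P) :
    QMod (R := R) R P ≃ₗ[R] QMod (R := R) R P :=
  extendAut (Polynomial.aeval (0 : R)) α

/-- `α(X)_m`: the localization at a prime `m` of an automorphism `α(X)` of `Q[X]`. -/
def localize (m : Ideal R) [m.IsPrime]
    (α : QMod (R := R) R[X] P ≃ₗ[R[X]] QMod (R := R) R[X] P) :
    QMod (R := R) (Localization.AtPrime m)[X] P ≃ₗ[(Localization.AtPrime m)[X]]
      QMod (R := R) (Localization.AtPrime m)[X] P :=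
  extendAut (Polynomial.mapAlgHom (Algebra.ofId R (Localization.AtPrime m))) α

/-- The group `ETrans_O(Q_A, I Q_A)` for an `R`-algebra `A` and an ideal `I` of `R`, where
`Q_A = A² ⊕ (A ⊗ P)` carries the form induced by the form `B` on `P`. -/
def ETransOver (A : Type*) [CommRing A] [Algebra R A] (I : Ideal R)
    (B : LinearMap.BilinForm R P) :
    Subgroup (QMod (R := R) A P ≃ₗ[A] QMod (R := R) A P) :=
  ETransRel (I.map (algebraMap R A)) (B.baseChange A)

end BaseChange

end OrthTrans

end

/-!
The proof is by the method of Quillen and Suslin: a dilation principle, followed by patching.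

**Generators.** The transvection `T(u, v) : x ↦ x - ⟨u, x⟩ v + ⟨v, x⟩ u` depends only on the
bivector `u ∧ v`, and is additive in `v` as long as the vectors involved span a totally isotropic
submodule. The elementary transvections are `elem B ε q = T(e_ε, q)`, with `q` isotropic and `e_ε`
one of the two basis vectors of `A²`. Sums and differences of isotropic vectors, such as `q(X) -
q(0)`, are not isotropic in general, which obstructs a direct comparison of `elem B ε q(X)` with
its value at `0`. At a maximal ideal `m`, however, the split module has a hyperbolic basis
(`IsSplit.exists_isHyperbolicBasis`). Since `2` is invertible, the two components of an isotropic
vector in the isotropic halves are orthogonal to each other, so that the elementary group is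
generated by the `elem B ε (c h)` with `h` in the hyperbolic basis and `c` a scalar
(`IsHyperbolicBasis.elementaryTransvections_subset`); here the coefficients `c` can be added. A
multiple of each basis vector lifts to an isotropic vector of the global module
(`HasDenominators.exists_smul_eq_tmul_isotropic`).

**Commutators.** If `p` and `q` are orthogonal then the commutator of two elementary transvections
of opposite kinds with parameters `p` and `q` is `T(q, p)`, which is bilinear in `p` and `q`.
Hence a denominator of `p` can be absorbed by `q`. If `⟨p, q⟩ = 1` then one uses a second
hyperbolic pair in order to write the transvection with parameter `q` as a commutator of
transvections which fall under the first case; this is where rank at least `4` is needed.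
Consequently conjugation by elements with denominators is continuous for the topology given by the
congruence subgroups `congrGroup`, and commutators with relative elements are small relative
elements (`exists_conj_mem_congrGroup`, `exists_commutator_mem_congrGroup`).

**Dilation.** It follows that `γ(θ) γ(0)⁻¹` lies in a given relative congruence subgroup when
`γ(X)` is in the relative elementary group over the localization and `θ` is sufficiently divisible
(`exists_specialize_mem_congrGroup`). Small congruence subgroups lift to the global elementary
group (`congrGroup_le_map`). The lift agrees with the given automorphism after localization and at
`X = 0`, hence also globally after another rescaling of the variable; the finite projectivity of
the module enters here. This is the dilation principle `exists_extendAut_subst_mem_ETransOver`.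

**Patching.** Applied to `α(X + Y) α(X)⁻¹` as an automorphism depending on `Y`, the dilation
principle shows that the ideal `quillenIdeal` of all `c` such that `α(f + c d) α(f)⁻¹` is
elementary for all polynomials `f` and `d` is contained in no maximal ideal. So it contains `1`,
and `f = 0`, `d = X` gives the theorem.
-/

noncomputable section

namespace OrthTrans

open scoped commutatorElement

/-! ### Orthogonal transvections -/

section Transvection

variable {A : Type*} [CommRing A] {V : Type*} [AddCommGroup V] [Module A V]

/-- The map `x ↦ x - ⟨u, x⟩ v + ⟨v, x⟩ u`, for arbitrary `u` and `v`. -/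
def transvectionEnd (B : LinearMap.BilinForm A V) (u v : V) : V →ₗ[A] V :=
  LinearMap.id - (B u).smulRight v + (B v).smulRight u

/-- The pair `u`, `v` spans a totally isotropic submodule. -/
def IsIsotropicPair (B : LinearMap.BilinForm A V) (u v : V) : Prop :=
  B u u = 0 ∧ B v v = 0 ∧ B u v = 0 ∧ B v u = 0

lemma transvectionEnd_apply (B : LinearMap.BilinForm A V) (u v x : V) :
    transvectionEnd B u v x = x - B u x • v + B v x • u := rfl

lemma transvectionEnd_comp_neg {B : LinearMap.BilinForm A V} {u v : V}
    (h : IsIsotropicPair B u v) :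
    transvectionEnd B u v ∘ₗ transvectionEnd B u (-v) = LinearMap.id := by
  obtain ⟨h1, h2, h3, h4⟩ := h
  ext x
  simp only [LinearMap.comp_apply, transvectionEnd_apply, map_add, map_sub, map_smul, map_neg,
    LinearMap.neg_apply, h1, h2, h3, h4, LinearMap.id_apply]
  module

lemma IsIsotropicPair.neg {B : LinearMap.BilinForm A V} {u v : V}
    (h : IsIsotropicPair B u v) : IsIsotropicPair B u (-v) := by
  obtain ⟨h1, h2, h3, h4⟩ := h
  simp [IsIsotropicPair, h1, h2, h3, h4]

open Classical in
/-- The orthogonal transvection `x ↦ x - ⟨u, x⟩ v + ⟨v, x⟩ u` as a linear automorphism. It has this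
value if `u`, `v` span a totally isotropic submodule; otherwise it is the identity by convention. -/
def transvection (B : LinearMap.BilinForm A V) (u v : V) : V ≃ₗ[A] V :=
  if h : IsIsotropicPair B u v then
    LinearEquiv.ofLinearMap (transvectionEnd B u v) (transvectionEnd B u (-v))
      (transvectionEnd_comp_neg h)
      (by simpa using transvectionEnd_comp_neg h.neg)
  else 1

variable {B : LinearMap.BilinForm A V}

lemma transvection_apply {u v : V} (h : IsIsotropicPair B u v) (x : V) :
    transvection B u v x = x - B u x • v + B v x • u := by
  rw [transvection, dif_pos h]
  rfl

lemma transvection_mul {u v w : V} (hv : IsIsotropicPair B u v) (hw : IsIsotropicPair B u w)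
    (hvw : B v w = 0) (hwv : B w v = 0) :
    transvection B u v * transvection B u w = transvection B u (v + w) := by
  have h : IsIsotropicPair B u (v + w) := by
    obtain ⟨h1, h2, h3, h4⟩ := hv
    obtain ⟨-, k2, k3, k4⟩ := hw
    simp [IsIsotropicPair, h1, h2, h3, h4, k2, k3, k4, hvw, hwv]
  ext x
  obtain ⟨h1, -, -, h4⟩ := id hv
  obtain ⟨-, -, k3, -⟩ := id hw
  simp only [LinearEquiv.mul_apply, transvection_apply hv, transvection_apply hw,
    transvection_apply h, map_add, map_sub, map_smul, LinearMap.add_apply, smul_eq_mul,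
    h1, h4, k3, hvw]
  module

lemma transvection_inv {u v : V} (h : IsIsotropicPair B u v) :
    (transvection B u v)⁻¹ = transvection B u (-v) := by
  refine inv_eq_of_mul_eq_one_right ?_
  ext x
  have := LinearMap.congr_fun (transvectionEnd_comp_neg h) x
  simpa [transvection_apply h, transvection_apply h.neg, transvectionEnd_apply,
    LinearMap.comp_apply] using this

/-- An orthogonal transvection depends only on the bivector `u ∧ v`. -/
lemma transvection_swap {u v : V} (h : IsIsotropicPair B u v) :
    transvection B u v = transvection B v (-u) := by
  have h' : IsIsotropicPair B v (-u) := by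
    obtain ⟨h1, h2, h3, h4⟩ := h
    simp [IsIsotropicPair, h1, h2, h3, h4]
  ext x
  simp only [transvection_apply h, transvection_apply h', map_neg, LinearMap.neg_apply]
  module

lemma transvection_smul_left {u v : V} (h : IsIsotropicPair B u v) (c : A) :
    transvection B (c • u) v = transvection B u (c • v) := by
  obtain ⟨h1, h2, h3, h4⟩ := h
  ext x
  rw [transvection_apply (by simp [IsIsotropicPair, h1, h2, h3, h4]),
    transvection_apply (by simp [IsIsotropicPair, h1, h2, h3, h4])]
  simp only [map_smul, LinearMap.smul_apply, smul_eq_mul]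
  module

lemma transvection_mem_orthogonalGroup (hs : ∀ x y, B x y = B y x) {u v : V}
    (h : IsIsotropicPair B u v) : transvection B u v ∈ orthogonalGroup B := by
  intro x y
  obtain ⟨h1, h2, h3, h4⟩ := id h
  simp only [transvection_apply h, map_add, map_sub, map_smul, LinearMap.add_apply,
    LinearMap.sub_apply, LinearMap.smul_apply, smul_eq_mul, h1, h2, h3, h4, hs x u, hs x v]
  ring

lemma transvection_conj {g : V ≃ₗ[A] V} (hg : g ∈ orthogonalGroup B) {u v : V}
    (h : IsIsotropicPair B u v) :
    g * transvection B u v * g⁻¹ = transvection B (g u) (g v) := by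
  have h' : IsIsotropicPair B (g u) (g v) := by
    simpa only [IsIsotropicPair, hg _ _] using h
  rw [mul_inv_eq_iff_eq_mul]
  ext x
  simp only [LinearEquiv.mul_apply, transvection_apply h, transvection_apply h', hg _ _, map_add,
    map_sub, map_smul]

end Transvection

/-! ### Elementary transvections and their commutators -/

section Elementary

variable {A : Type*} [CommRing A] {M : Type*} [AddCommGroup M] [Module A M]

/-- The hyperbolic pair which spans the summand `A²` of `A² ⊕ M`. -/
def hypVec (A M : Type*) [CommRing A] [AddCommGroup M] : Bool → A × A × M
  | true => (0, 1, 0)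
  | false => (1, 0, 0)

lemma hypSum_apply (B : LinearMap.BilinForm A M) (x y : A × A × M) :
    hypSum B x y = x.1 * y.2.1 + x.2.1 * y.1 + B x.2.2 y.2.2 := rfl

lemma hypSum_symm {B : LinearMap.BilinForm A M} (hs : ∀ x y, B x y = B y x) (x y : A × A × M) :
    hypSum B x y = hypSum B y x := by
  rw [hypSum_apply, hypSum_apply, hs x.2.2]
  ring

/-- The elementary orthogonal transvection with parameter `q`: of the first of the two kinds
`(a, b, p) ↦ (a, b + ⟨p, q⟩, p - a q)` and `(a, b, p) ↦ (a + ⟨p, q⟩, b, p - b q)` for the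
index `true`, of the second kind for `false`. It is the identity unless `q` is isotropic. -/
def elem (B : LinearMap.BilinForm A M) (ε : Bool) (q : M) : (A × A × M) ≃ₗ[A] (A × A × M) :=
  transvection (hypSum B) (hypVec A M ε) (0, 0, q)

/-- The transvection of `A² ⊕ M` with the parameters `q` and `p` in `M`. It is the identity unless
`q` and `p` are isotropic and orthogonal to each other. -/
def siegel (B : LinearMap.BilinForm A M) (q p : M) : (A × A × M) ≃ₗ[A] (A × A × M) :=
  transvection (hypSum B) (0, 0, q) (0, 0, p)

variable {B : LinearMap.BilinForm A M}

lemma isIsotropicPair_hypVec {q : M} (hq : B q q = 0) (ε : Bool) :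
    IsIsotropicPair (hypSum B) (hypVec A M ε) (0, 0, q) := by
  cases ε <;> simp [IsIsotropicPair, hypSum_apply, hypVec, hq]

lemma isIsotropicPair_inr (hs : ∀ x y, B x y = B y x) {p q : M} (hp : B p p = 0) (hq : B q q = 0)
    (hpq : B p q = 0) : IsIsotropicPair (hypSum B) ((0, 0, p) : A × A × M) (0, 0, q) := by
  simp [IsIsotropicPair, hypSum_apply, hp, hq, hpq, hs q p]

lemma elem_true_apply {q : M} (hq : B q q = 0) (x : A × A × M) :
    elem B true q x = (x.1, x.2.1 + B q x.2.2, x.2.2 - x.1 • q) := by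
  rw [elem, transvection_apply (isIsotropicPair_hypVec hq _)]
  simp [hypSum_apply, hypVec, Prod.ext_iff]

lemma elem_false_apply {q : M} (hq : B q q = 0) (x : A × A × M) :
    elem B false q x = (x.1 + B q x.2.2, x.2.1, x.2.2 - x.2.1 • q) := by
  rw [elem, transvection_apply (isIsotropicPair_hypVec hq _)]
  simp [hypSum_apply, hypVec, Prod.ext_iff]

lemma elem_mem_orthogonalGroup (hs : ∀ x y, B x y = B y x) (ε : Bool) {q : M} (hq : B q q = 0) :
    elem B ε q ∈ orthogonalGroup (hypSum B) :=
  transvection_mem_orthogonalGroup (hypSum_symm hs) (isIsotropicPair_hypVec hq _)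

lemma siegel_mem_orthogonalGroup (hs : ∀ x y, B x y = B y x) {p q : M} (hp : B p p = 0)
    (hq : B q q = 0) (hpq : B p q = 0) : siegel B p q ∈ orthogonalGroup (hypSum B) :=
  transvection_mem_orthogonalGroup (hypSum_symm hs) (isIsotropicPair_inr hs hp hq hpq)

lemma elem_conj {g : (A × A × M) ≃ₗ[A] (A × A × M)} (hg : g ∈ orthogonalGroup (hypSum B))
    {ε : Bool} {q : M} (hq : B q q = 0) :
    g * elem B ε q * g⁻¹ = transvection (hypSum B) (g (hypVec A M ε)) (g (0, 0, q)) :=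
  transvection_conj hg (isIsotropicPair_hypVec hq _)

lemma elem_zero (ε : Bool) : elem B ε 0 = 1 := by
  ext x <;> cases ε <;>
    simp [elem_true_apply (B := B) (q := 0) (by simp), elem_false_apply (B := B) (q := 0) (by simp)]

lemma elem_mul (hs : ∀ x y, B x y = B y x) (ε : Bool) {p q : M} (hp : B p p = 0) (hq : B q q = 0)
    (hpq : B p q = 0) : elem B ε p * elem B ε q = elem B ε (p + q) := by
  rw [elem, elem, transvection_mul (isIsotropicPair_hypVec hp _) (isIsotropicPair_hypVec hq _)
    (by simp [hypSum_apply, hpq]) (by simp [hypSum_apply, hs q p, hpq]), elem]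
  simp

lemma elem_inv (ε : Bool) {q : M} (hq : B q q = 0) : (elem B ε q)⁻¹ = elem B ε (-q) := by
  rw [elem, transvection_inv (isIsotropicPair_hypVec hq _), elem]
  simp

/-- Elementary transvections of the same kind commute even if their parameters are not
orthogonal. -/
lemma commute_elem (hs : ∀ x y, B x y = B y x) (ε : Bool) {p q : M} (hp : B p p = 0)
    (hq : B q q = 0) : Commute (elem B ε p) (elem B ε q) := by
  refine LinearEquiv.ext fun x => ?_
  cases ε
  · simp only [LinearEquiv.mul_apply, elem_false_apply hp, elem_false_apply hq, map_sub, map_smul,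
      hs q p, Prod.mk.injEq, smul_eq_mul]
    exact ⟨by ring, trivial, by module⟩
  · simp only [LinearEquiv.mul_apply, elem_true_apply hp, elem_true_apply hq, map_sub, map_smul,
      hs q p, Prod.mk.injEq, smul_eq_mul]
    exact ⟨trivial, by ring, by module⟩

lemma siegel_smul_left (hs : ∀ x y, B x y = B y x) {p q : M} (hp : B p p = 0) (hq : B q q = 0)
    (hpq : B p q = 0) (c : A) : siegel B (c • p) q = siegel B p (c • q) := by
  simpa [siegel] using transvection_smul_left (isIsotropicPair_inr hs hp hq hpq) c

/-- The commutator of elementary transvections of opposite kinds with orthogonal parameters. -/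
lemma elem_commutator_elem_not (hs : ∀ x y, B x y = B y x) (ε : Bool) {p q : M} (hp : B p p = 0)
    (hq : B q q = 0) (hpq : B p q = 0) : ⁅elem B ε p, elem B (!ε) q⁆ = siegel B q p := by
  have hqp : B q p = 0 := by rw [hs, hpq]
  have e1 : elem B ε p (hypVec A M (!ε)) = hypVec A M (!ε) - (0, 0, p) := by
    cases ε <;> simp [hypVec, elem_true_apply hp, elem_false_apply hp]
  have e2 : elem B ε p (0, 0, q) = (0, 0, q) := by
    cases ε <;> simp [elem_true_apply hp, elem_false_apply hp, hpq]
  have h1 : IsIsotropicPair (hypSum B) (hypVec A M (!ε) - (0, 0, p)) (0, 0, q) := by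
    cases ε <;> simp [IsIsotropicPair, hypSum_apply, hypVec, hp, hq, hpq, hqp]
  have h2 : IsIsotropicPair (hypSum B) (0, 0, q) (-hypVec A M (!ε)) := by
    cases ε <;> simp [IsIsotropicPair, hypSum_apply, hypVec, hq]
  rw [commutatorElement_def, elem_conj (elem_mem_orthogonalGroup hs ε hp) hq, e1, e2,
    mul_inv_eq_iff_eq_mul, transvection_swap h1, elem,
    transvection_swap (isIsotropicPair_hypVec hq _), siegel, transvection_mul (isIsotropicPair_inr hs hq hp hqp) h2
    (by cases ε <;> simp [hypSum_apply, hypVec]) (by cases ε <;> simp [hypSum_apply, hypVec])]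
  congr 1
  abel

/-- An elementary transvection is a commutator of transvections whose parameters are orthogonal
to a given vector dual to its own parameter. -/
lemma siegel_commutator_elem (hs : ∀ x y, B x y = B y x) (ε : Bool) {q x y : M} (hq : B q q = 0)
    (hx : B x x = 0) (hy : B y y = 0) (hqx : B q x = 0) (hqy : B q y = 0) :
    ⁅siegel B q x, elem B ε y⁆ = elem B ε (B x y • q) := by
  have hqp : B x q = 0 := by rw [hs, hqx]
  have e1 : siegel B q x (hypVec A M ε) = hypVec A M ε := by
    rw [siegel, transvection_apply (isIsotropicPair_inr hs hq hx hqx)]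
    cases ε <;> simp [hypVec, hypSum_apply]
  have e2 : siegel B q x (0, 0, y) = (0, 0, B x y • q + y) := by
    rw [siegel, transvection_apply (isIsotropicPair_inr hs hq hx hqx)]
    simp [hypSum_apply, hqy, add_comm]
  rw [commutatorElement_def, elem_conj (siegel_mem_orthogonalGroup hs hq hx hqx) hy, e1, e2,
    mul_inv_eq_iff_eq_mul]
  exact (elem_mul hs ε (by simp [hq]) hy (by simp [hqy])).symm

/-- Conjugation of a transvection with parameters in `M` by an elementary transvection whose
parameter is orthogonal to one of the two. -/
lemma elem_conj_siegel (hs : ∀ x y, B x y = B y x) (ε : Bool) {p q x : M} (hp : B p p = 0)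
    (hq : B q q = 0) (hx : B x x = 0) (hqx : B q x = 0) (hpx : B p x = 0) :
    elem B ε p * siegel B q x * (elem B ε p)⁻¹ = siegel B q x * elem B ε (B p q • x) := by
  have hxq : B x q = 0 := by rw [hs, hqx]
  have e1 : elem B ε p (0, 0, q) = (0, 0, q) + B p q • hypVec A M ε := by
    cases ε <;> simp [hypVec, elem_true_apply hp, elem_false_apply hp]
  have e2 : elem B ε p (0, 0, x) = (0, 0, x) := by
    cases ε <;> simp [elem_true_apply hp, elem_false_apply hp, hpx]
  have h1 : IsIsotropicPair (hypSum B) ((0, 0, q) + B p q • hypVec A M ε) (0, 0, x) := by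
    cases ε <;> simp [IsIsotropicPair, hypSum_apply, hypVec, hq, hx, hqx, hxq]
  have h2 : IsIsotropicPair (hypSum B) (0, 0, x) (-(0, 0, q)) :=
    (isIsotropicPair_inr hs hx hq hxq).neg
  have h3 : IsIsotropicPair (hypSum B) (0, 0, x) (-(B p q • hypVec A M ε)) := by
    cases ε <;> simp [IsIsotropicPair, hypSum_apply, hypVec, hx]
  have h4 : IsIsotropicPair (hypSum B) (B p q • hypVec A M ε) (0, 0, x) := by
    cases ε <;> simp [IsIsotropicPair, hypSum_apply, hypVec, hx]
  have e3 : elem B ε (B p q • x) = transvection (hypSum B) (0, 0, x)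
      (-(B p q • hypVec A M ε)) := by
    rw [← transvection_swap h4, transvection_smul_left (isIsotropicPair_hypVec hx _), elem]
    simp
  rw [e3, siegel, transvection_conj (elem_mem_orthogonalGroup hs ε hp)
    (isIsotropicPair_inr hs hq hx hqx), e1, e2, transvection_swap h1,
    transvection_swap (isIsotropicPair_inr hs hq hx hqx), transvection_mul h2 h3
    (by cases ε <;> simp [hypSum_apply, hypVec]) (by cases ε <;> simp [hypSum_apply, hypVec])]
  congr 1
  abel

end Elementary

/-! ### Relative normal closures -/

section RelClosure

variable {G : Type*} [Group G]

/-- The subgroup generated by the conjugates of the elements of `T` under the subgroup generated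
by `S`; for `T ⊆ S` it is the normal closure of `T` in `closure S`. -/
def relClosure (S T : Set G) : Subgroup G :=
  Subgroup.closure {x | ∃ g ∈ Subgroup.closure S, ∃ y ∈ T, g * y * g⁻¹ = x}

lemma conj_mem_relClosure {S T : Set G} {g x : G} (hg : g ∈ Subgroup.closure S)
    (hx : x ∈ relClosure S T) : g * x * g⁻¹ ∈ relClosure S T := by
  induction hx using Subgroup.closure_induction with
  | mem x hx =>
    obtain ⟨k, hk, y, hy, rfl⟩ := hx
    exact Subgroup.subset_closure ⟨g * k, mul_mem hg hk, y, hy, by group⟩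
  | one => simp
  | mul x y _ _ hx hy => simpa only [conj_mul] using mul_mem hx hy
  | inv x _ hx => simpa only [conj_inv] using inv_mem hx

lemma subset_relClosure {S T : Set G} {x : G} (hx : x ∈ T) : x ∈ relClosure S T :=
  Subgroup.subset_closure ⟨1, one_mem _, x, hx, by simp⟩

lemma relClosure_le {S T : Set G} {K : Subgroup G}
    (h : ∀ g ∈ Subgroup.closure S, ∀ y ∈ T, g * y * g⁻¹ ∈ K) : relClosure S T ≤ K := by
  rw [relClosure, Subgroup.closure_le]
  rintro _ ⟨g, hg, y, hy, rfl⟩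
  exact h g hg y hy

lemma relClosure_le_closure {S T : Set G} (h : T ⊆ S) : relClosure S T ≤ Subgroup.closure S :=
  relClosure_le fun _ hg _ hy =>
    mul_mem (mul_mem hg (Subgroup.subset_closure (h hy))) (inv_mem hg)

lemma relClosure_self (S : Set G) : relClosure S S = Subgroup.closure S :=
  le_antisymm (relClosure_le_closure subset_rfl)
    ((Subgroup.closure_le _).2 fun _ hx => subset_relClosure hx)

lemma relClosure_mono {S T S' T' : Set G} (hS : S ⊆ S') (hT : T ⊆ T') :
    relClosure S T ≤ relClosure S' T' :=
  relClosure_le fun _ hg _ hy => conj_mem_relClosure (Subgroup.closure_mono hS hg)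
    (subset_relClosure (hT hy))

lemma relClosure_le_of_le {S T S' T' : Set G} (hS : S ⊆ Subgroup.closure S')
    (hT : T ⊆ relClosure S' T') : relClosure S T ≤ relClosure S' T' :=
  relClosure_le fun _ hg _ hy => conj_mem_relClosure ((Subgroup.closure_le _).2 hS hg) (hT hy)

lemma commutator_mem_relClosure {S T : Set G} {a b : G} (ha : a ∈ Subgroup.closure S)
    (hb : b ∈ Subgroup.closure S) (h : a ∈ relClosure S T ∨ b ∈ relClosure S T) :
    ⁅a, b⁆ ∈ relClosure S T := by
  rw [commutatorElement_def]
  rcases h with h | h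
  · have := mul_mem h (conj_mem_relClosure hb (inv_mem h))
    simpa only [mul_assoc] using this
  · exact mul_mem (conj_mem_relClosure ha h) (inv_mem h)

/-- If `b ≡ 1`, and `a ≡ 1` or `d ≡ 1`, modulo a normal subgroup, then
`[a b, d c] ≡ [a, c]` modulo that subgroup. -/
lemma commutator_mul_mul_mem_relClosure {S T : Set G} {a b c d : G}
    (hTS : T ⊆ S) (ha : a ∈ Subgroup.closure S)
    (hc : c ∈ Subgroup.closure S) (hd : d ∈ Subgroup.closure S) (hb : b ∈ relClosure S T)
    (h : a ∈ relClosure S T ∨ d ∈ relClosure S T) :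
    ⁅a * b, d * c⁆ * ⁅a, c⁆⁻¹ ∈ relClosure S T := by
  have hb' := relClosure_le_closure hTS hb
  have e : ⁅a * b, d * c⁆ * ⁅a, c⁆⁻¹ =
      (a * ⁅b, d * c⁆ * a⁻¹) * (⁅a, d⁆ * (d * (⁅a, c⁆ * d⁻¹ * ⁅a, c⁆⁻¹))) := by
    simp only [commutatorElement_def]
    group
  rw [e]
  refine mul_mem (conj_mem_relClosure ha (commutator_mem_relClosure hb' (mul_mem hd hc)
    (Or.inl hb))) ?_
  rcases h with h | h
  · refine mul_mem (commutator_mem_relClosure ha hd (Or.inl h)) ?_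
    have hac := commutator_mem_relClosure (T := T) ha hc (Or.inl h)
    have := commutator_mem_relClosure hd (relClosure_le_closure hTS hac) (Or.inr hac)
    simpa only [commutatorElement_def, mul_assoc] using this
  · refine mul_mem (commutator_mem_relClosure ha hd (Or.inr h)) (mul_mem h ?_)
    refine conj_mem_relClosure ?_ (inv_mem h)
    rw [commutatorElement_def]
    exact mul_mem (mul_mem (mul_mem ha hc) (inv_mem ha)) (inv_mem hc)

lemma map_mem_relClosure {G' : Type*} [Group G'] (f : G →* G') {S T : Set G}
    {S' T' : Set G'} (hS : ∀ s ∈ S, f s ∈ Subgroup.closure S')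
    (hT : ∀ y ∈ T, f y ∈ relClosure S' T') {x : G} (hx : x ∈ relClosure S T) :
    f x ∈ relClosure S' T' := by
  have hS' : Subgroup.closure S ≤ (Subgroup.closure S').comap f := (Subgroup.closure_le _).2 hS
  refine relClosure_le (K := (relClosure S' T').comap f) (fun g hg y hy => ?_) hx
  rw [Subgroup.mem_comap, map_mul, map_mul, map_inv]
  exact conj_mem_relClosure (hS' hg) (hT y hy)

end RelClosure

/-! ### Congruence subgroups -/

section Congruence

variable {D D' : Type*} [CommRing D] [CommRing D'] {M : Type*} [AddCommGroup M] [Module D' M]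

/-- A set of isotropic vectors such that any two of them are orthogonal, or have product `1` and
are both orthogonal to some further hyperbolic pair of vectors in the set. -/
structure IsHyperbolicSet (B : LinearMap.BilinForm D' M) (H : Set M) : Prop where
  isotropic : ∀ h ∈ H, B h h = 0
  pair : ∀ p ∈ H, ∀ q ∈ H, B p q = 0 ∨ (B p q = 1 ∧ ∃ x ∈ H, ∃ y ∈ H, B x y = 1 ∧
    B p x = 0 ∧ B p y = 0 ∧ B q x = 0 ∧ B q y = 0)

/-- The elementary transvections whose parameters are multiples of vectors in `H` by elements of
the image of `t J`. -/
def congrGen (φ : D →+* D') (B : LinearMap.BilinForm D' M) (H : Set M) (t : D) (J : Ideal D) :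
    Set ((D' × D' × M) ≃ₗ[D'] (D' × D' × M)) :=
  {g | ∃ ε, ∃ h ∈ H, ∃ r ∈ J, elem B ε (φ (t * r) • h) = g}

/-- The normal closure of the elementary transvections of level `t J` in the group generated by
those of level `t D`. -/
def congrGroup (φ : D →+* D') (B : LinearMap.BilinForm D' M) (H : Set M) (t : D) (J : Ideal D) :
    Subgroup ((D' × D' × M) ≃ₗ[D'] (D' × D' × M)) :=
  relClosure (congrGen φ B H t ⊤) (congrGen φ B H t J)

/-- The elementary transvections whose parameters are multiples of vectors in `H` by elements of
`J'`. -/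
def rootGen (B : LinearMap.BilinForm D' M) (H : Set M) (J' : Ideal D') :
    Set ((D' × D' × M) ≃ₗ[D'] (D' × D' × M)) :=
  {g | ∃ ε, ∃ h ∈ H, ∃ c ∈ J', elem B ε (c • h) = g}

variable {φ : D →+* D'} {B : LinearMap.BilinForm D' M} {H : Set M}

lemma elem_mem_congrGroup {ε : Bool} {h : M} (hh : h ∈ H) {t r : D} {J : Ideal D} (hr : r ∈ J) :
    elem B ε (φ (t * r) • h) ∈ congrGroup φ B H t J :=
  subset_relClosure ⟨ε, h, hh, r, hr, rfl⟩

lemma congrGen_mono {J J' : Ideal D} (h : J ≤ J') (t : D) :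
    congrGen φ B H t J ⊆ congrGen φ B H t J' := by
  rintro _ ⟨ε, x, hx, r, hr, rfl⟩
  exact ⟨ε, x, hx, r, h hr, rfl⟩

lemma congrGen_mul (t s : D) (J : Ideal D) : congrGen φ B H (t * s) J ⊆ congrGen φ B H t J := by
  rintro _ ⟨ε, x, hx, r, hr, rfl⟩
  exact ⟨ε, x, hx, s * r, J.mul_mem_left _ hr, by rw [mul_assoc]⟩

lemma congrGroup_top (t : D) :
    congrGroup φ B H t ⊤ = Subgroup.closure (congrGen φ B H t ⊤) := relClosure_self _

lemma congrGroup_mul_le (t s : D) (J : Ideal D) :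
    congrGroup φ B H (t * s) J ≤ congrGroup φ B H t J :=
  relClosure_mono (congrGen_mul _ _ _) (congrGen_mul _ _ _)

lemma conj_mem_congrGroup {t : D} {J : Ideal D} {g x : (D' × D' × M) ≃ₗ[D'] (D' × D' × M)}
    (hg : g ∈ congrGroup φ B H t ⊤) (hx : x ∈ congrGroup φ B H t J) :
    g * x * g⁻¹ ∈ congrGroup φ B H t J :=
  conj_mem_relClosure (congrGroup_top (φ := φ) (B := B) t ▸ hg) hx

/-- By bilinearity the transvection is a commutator of elementary transvections of level `t`, one of
which is of level `t J`. -/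
lemma siegel_mem_congrGroup (hs : ∀ x y, B x y = B y x) (hH : IsHyperbolicSet B H) {p q : M}
    (hp : p ∈ H) (hq : q ∈ H) (hqp : B q p = 0) {t d r : D} {J : Ideal D} (h : d ∈ J ∨ r ∈ J) :
    siegel B q (φ (t * d * (t * r)) • p) ∈ congrGroup φ B H t J := by
  have hp0 := hH.isotropic p hp
  have hq0 := hH.isotropic q hq
  have hpq : B p q = 0 := by rw [hs, hqp]
  have e : siegel B q (φ (t * d * (t * r)) • p) =
      ⁅elem B true (φ (t * d) • p), elem B (!true) (φ (t * r) • q)⁆ := by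
    rw [elem_commutator_elem_not hs true (by simp [hp0]) (by simp [hq0]) (by simp [hpq]),
      siegel_smul_left hs hq0 (by simp [hp0]) (by simp [hqp]), smul_smul, map_mul φ (t * d),
      mul_comm (φ (t * d))]
  rw [e]
  refine commutator_mem_relClosure
    (Subgroup.subset_closure ⟨_, p, hp, d, Submodule.mem_top, rfl⟩)
    (Subgroup.subset_closure ⟨_, q, hq, r, Submodule.mem_top, rfl⟩) ?_
  exact h.imp (elem_mem_congrGroup hp) (elem_mem_congrGroup hq)

/-- The commutator of an elementary transvection with parameter `c p`, where `c` has denominator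
`u` and numerator `d`, with one of a sufficiently small level, lies in the given congruence
subgroup. If the two parameters are not orthogonal then the second transvection is written as a
commutator of transvections with parameters orthogonal to `p`. -/
lemma commutator_elem_mem_congrGroup (hs : ∀ x y, B x y = B y x) (hH : IsHyperbolicSet B H)
    {p q : M} (hp : p ∈ H) (hq : q ∈ H) {c : D'} {u d : D} (hc : φ u * c = φ d) (t : D)
    (ε ε' : Bool) {r : D} {J : Ideal D} (h : d ∈ J ∨ r ∈ J) :
    ⁅elem B ε (c • p), elem B ε' (φ ((t * u * t) * (t * u * t) * r) • q)⁆ ∈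
      congrGroup φ B H t J := by
  have hp0 := hH.isotropic p hp
  have hq0 := hH.isotropic q hq
  obtain rfl | hε : ε' = ε ∨ ε' = !ε := by cases ε <;> cases ε' <;> simp
  · rw [(commutatorElement_eq_one_iff_commute).2
      (commute_elem hs _ (by simp [hp0]) (by simp [hq0]))]
    exact one_mem _
  subst hε
  -- The case of orthogonal parameters. It also covers the commutator with `k` below.
  have key : ∀ {x y : M}, x ∈ H → y ∈ H → B y x = 0 → ∀ {s : D} {J' : Ideal D},
      (d ∈ J' ∨ s ∈ J') →
      ⁅elem B ε (c • x), elem B (!ε) (φ (t * u * t * s) • y)⁆ ∈ congrGroup φ B H t J' := by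
    intro x y hx hy hyx s J' hs'
    have hx0 := hH.isotropic x hx
    have hy0 := hH.isotropic y hy
    rw [elem_commutator_elem_not hs ε (by simp [hx0]) (by simp [hy0]) (by simp [hs x, hyx]),
      siegel_smul_left hs hy0 (by simp [hx0]) (by simp [hyx]), smul_smul]
    have : φ (t * u * t * s) * c = φ (t * d * (t * s)) := by
      simp only [map_mul, ← hc]
      ring
    rw [this]
    exact siegel_mem_congrGroup hs hH hx hy hyx hs'
  rcases hH.pair p hp q hq with hpq | ⟨hpq, x, hx, y, hy, hxy, hpx, hpy, hqx, hqy⟩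
  · rw [mul_assoc]
    exact key hp hq (by rw [hs, hpq]) (h.imp id (J.mul_mem_left _))
  have hx0 := hH.isotropic x hx
  have hy0 := hH.isotropic y hy
  -- The level `τ ^ 2` is distributed over the two factors of the commutator `⁅a, k⁆`; in `τ` the
  -- factor `u` clears the denominator of `c`, and each `t` is left for one transvection.
  set τ := t * u * t with hτ
  set a := siegel B q (φ (τ * r) • x) with ha
  set b := elem B ε ((φ (τ * r) * c) • x) with hb
  set k := elem B (!ε) (φ τ • y) with hk
  set e := elem B ε (c • p) with he
  have hk' : k ∈ congrGroup φ B H t ⊤ := by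
    have := elem_mem_congrGroup (φ := φ) (B := B) (ε := !ε) hy (t := t) (r := u * t)
      (J := ⊤) Submodule.mem_top
    rwa [← mul_assoc] at this
  have h1 : elem B (!ε) (φ (τ * τ * r) • q) = ⁅a, k⁆ := by
    rw [ha, hk, siegel_commutator_elem hs _ hq0 (by simp [hx0]) (by simp [hy0]) (by simp [hqx])
      (by simp [hqy])]
    congr 2
    simp only [map_mul, map_smul, LinearMap.smul_apply, smul_eq_mul, hxy]
    ring
  have h2 : e * a * e⁻¹ = a * b := by
    rw [he, ha, elem_conj_siegel hs _ (by simp [hp0]) hq0 (by simp [hx0]) (by simp [hqx])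
      (by simp [hpx]), hb]
    congr 2
    simp only [map_smul, LinearMap.smul_apply, smul_eq_mul, hpq, smul_smul]
    congr 1
    ring
  have h3 : e * k * e⁻¹ = ⁅e, k⁆ * k := by rw [commutatorElement_def]; group
  have h4 : ∀ {J' : Ideal D}, (d ∈ J' ∨ r ∈ J') → b ∈ congrGroup φ B H t J' := by
    intro J' h'
    have : φ (τ * r) * c = φ (t * (t * d * r)) := by
      simp only [hτ, map_mul, ← hc]
      ring
    rw [hb, this]
    refine elem_mem_congrGroup hx ?_
    rcases h' with h' | h'
    · exact J'.mul_mem_right _ (J'.mul_mem_left _ h')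
    · exact J'.mul_mem_left _ h'
  have h5 : ∀ {J' : Ideal D}, r ∈ J' → a ∈ congrGroup φ B H t J' := by
    intro J' h'
    have := siegel_mem_congrGroup (φ := φ) (t := t) (d := u) hs hH hx hq hqx (Or.inr h')
    rwa [show t * u * (t * r) = τ * r by rw [hτ]; ring] at this
  have h6 : ∀ {J' : Ideal D}, d ∈ J' → ⁅e, k⁆ ∈ congrGroup φ B H t J' := by
    intro J' h'
    have := key hp hy (by rw [hs, hpy]) (s := 1) (Or.inl h')
    rwa [mul_one] at this
  have h7 : ⁅e, ⁅a, k⁆⁆ = ⁅a * b, ⁅e, k⁆ * k⁆ * ⁅a, k⁆⁻¹ := by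
    rw [← h2, ← h3]
    simp only [commutatorElement_def]
    group
  rw [h1, h7]
  have top {x} (hx : x ∈ congrGroup φ B H t ⊤) :
      x ∈ Subgroup.closure (congrGen φ B H t ⊤) := by rwa [← congrGroup_top]
  exact commutator_mul_mul_mem_relClosure (congrGen_mono le_top t) (top (h5 Submodule.mem_top))
    (top hk') (top (h6 Submodule.mem_top)) (h4 h) (h.symm.imp h5 h6)

lemma inv_mem_rootGen (hH : IsHyperbolicSet B H) {J' : Ideal D'}
    {g : (D' × D' × M) ≃ₗ[D'] (D' × D' × M)} (hg : g ∈ rootGen B H J') :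
    g⁻¹ ∈ rootGen B H J' := by
  obtain ⟨ε, h, hh, c, hc, rfl⟩ := hg
  refine ⟨ε, h, hh, -c, neg_mem hc, ?_⟩
  rw [elem_inv _ (by simp [hH.isotropic h hh]), neg_smul]

lemma rootGen_subset_top (J' : Ideal D') : rootGen B H J' ⊆ rootGen B H ⊤ := by
  rintro _ ⟨ε, h, hh, c, -, rfl⟩
  exact ⟨ε, h, hh, c, Submodule.mem_top, rfl⟩

lemma congrGroup_mul_le' (t s : D) (J : Ideal D) :
    congrGroup φ B H (t * s) J ≤ congrGroup φ B H s J :=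
  mul_comm t s ▸ congrGroup_mul_le s t J

lemma exists_conj_mem_congrGroup_of_mem_rootGen (hs : ∀ x y, B x y = B y x)
    (hH : IsHyperbolicSet B H) {Θ : Submonoid D}
    (hden : ∀ c : D', ∃ u ∈ Θ, ∃ d, φ u * c = φ d)
    {g : (D' × D' × M) ≃ₗ[D'] (D' × D' × M)} (hg : g ∈ rootGen B H ⊤) (J : Ideal D) :
    ∀ t ∈ Θ, ∃ t' ∈ Θ, ∀ x ∈ congrGroup φ B H t' J, g * x * g⁻¹ ∈ congrGroup φ B H t J := by
  intro t ht
  obtain ⟨ε, p, hp, c, -, rfl⟩ := hg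
  obtain ⟨u, hu, d, hd⟩ := hden c
  have hτ : t * u * t ∈ Θ := mul_mem (mul_mem ht hu) ht
  refine ⟨(t * u * t) * (t * u * t), mul_mem hτ hτ, fun x hx => ?_⟩
  have key : ∀ J : Ideal D, ∀ y ∈ congrGen φ B H ((t * u * t) * (t * u * t)) J,
      MulAut.conj (elem B ε (c • p)) y ∈ congrGroup φ B H t J := by
    rintro J _ ⟨ε', q, hq, r, hr, rfl⟩
    rw [conj_eq_commutatorElement_mul]
    refine mul_mem (commutator_elem_mem_congrGroup hs hH hp hq hd t ε ε' (Or.inr hr)) ?_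
    rw [show (t * u * t) * (t * u * t) * r = t * (u * t * (t * u * t) * r) by ring]
    exact elem_mem_congrGroup hq (J.mul_mem_left _ hr)
  refine map_mem_relClosure (MulAut.conj (elem B ε (c • p))).toMonoidHom
    (fun y hy => ?_) (key J) hx
  rw [← congrGroup_top]
  exact key ⊤ y hy

/-- Conjugation by a transvection with denominators is continuous for the topology in which the
congruence subgroups are a basis of neighbourhoods of the identity. -/
lemma exists_conj_mem_congrGroup (hs : ∀ x y, B x y = B y x)
    (hH : IsHyperbolicSet B H) {Θ : Submonoid D}
    (hden : ∀ c : D', ∃ u ∈ Θ, ∃ d, φ u * c = φ d)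
    {g : (D' × D' × M) ≃ₗ[D'] (D' × D' × M)} (hg : g ∈ Subgroup.closure (rootGen B H ⊤))
    (J : Ideal D) :
    ∀ t ∈ Θ, ∃ t' ∈ Θ, ∀ x ∈ congrGroup φ B H t' J, g * x * g⁻¹ ∈ congrGroup φ B H t J := by
  induction hg using Subgroup.closure_induction'' with
  | mem g hg => exact exists_conj_mem_congrGroup_of_mem_rootGen hs hH hden hg J
  | inv_mem g hg =>
    exact exists_conj_mem_congrGroup_of_mem_rootGen hs hH hden (inv_mem_rootGen hH hg) J
  | one => exact fun t ht => ⟨t, ht, fun x hx => by simpa using hx⟩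
  | mul g k _ _ hg hk =>
    intro t ht
    obtain ⟨t₁, ht₁, h₁⟩ := hg t ht
    obtain ⟨t₂, ht₂, h₂⟩ := hk t₁ ht₁
    exact ⟨t₂, ht₂, fun x hx => by simpa only [mul_inv_rev, mul_assoc] using h₁ _ (h₂ x hx)⟩

lemma exists_commutator_mem_congrGroup_of_mem_rootGen (hs : ∀ x y, B x y = B y x)
    (hH : IsHyperbolicSet B H) {Θ : Submonoid D} {J : Ideal D} {J' : Ideal D'}
    (hden : ∀ c ∈ J', ∃ u ∈ Θ, ∃ d ∈ J, φ u * c = φ d)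
    {y : (D' × D' × M) ≃ₗ[D'] (D' × D' × M)} (hy : y ∈ rootGen B H J') :
    ∀ t ∈ Θ, ∃ t' ∈ Θ, ∀ x ∈ congrGroup φ B H t' ⊤, ⁅y, x⁆ ∈ congrGroup φ B H t J := by
  intro t ht
  obtain ⟨ε, p, hp, c, hc, rfl⟩ := hy
  obtain ⟨u, hu, d, hdJ, hd⟩ := hden c hc
  have hτ : t * u * t ∈ Θ := mul_mem (mul_mem ht hu) ht
  refine ⟨(t * u * t) * (t * u * t), mul_mem hτ hτ, fun x hx => ?_⟩
  have hle : congrGroup φ B H ((t * u * t) * (t * u * t)) ⊤ ≤ congrGroup φ B H t ⊤ := by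
    rw [show (t * u * t) * (t * u * t) = t * (u * t * (t * u * t)) by ring]
    exact congrGroup_mul_le _ _ _
  rw [congrGroup_top] at hx
  rw [congrGroup_top] at hle
  induction hx using Subgroup.closure_induction with
  | mem x hx =>
    obtain ⟨ε', q, hq, r, -, rfl⟩ := hx
    exact commutator_elem_mem_congrGroup hs hH hp hq hd t ε ε' (Or.inl hdJ)
  | one => simp
  | mul x y hx hy h₁ h₂ =>
    rw [commutatorElement_mul_right_eq_mul_conj, mul_assoc, mul_assoc, ← mul_assoc x]
    exact mul_mem h₁ (conj_mem_congrGroup (hle hx) h₂)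
  | inv x hx h₁ =>
    rw [commutatorElement_inv_right, ← commutatorElement_inv]
    simpa using conj_mem_congrGroup (inv_mem (hle hx)) (inv_mem h₁)

/-- Commutators of a relative element with denominators and elements of a sufficiently small
congruence subgroup are small relative elements. -/
lemma exists_commutator_mem_congrGroup (hs : ∀ x y, B x y = B y x)
    (hH : IsHyperbolicSet B H) {Θ : Submonoid D} {J : Ideal D} {J' : Ideal D'}
    (hden : ∀ c : D', ∃ u ∈ Θ, ∃ d, φ u * c = φ d)
    (hdenJ : ∀ c ∈ J', ∃ u ∈ Θ, ∃ d ∈ J, φ u * c = φ d)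
    {w : (D' × D' × M) ≃ₗ[D'] (D' × D' × M)}
    (hw : w ∈ relClosure (rootGen B H ⊤) (rootGen B H J')) :
    ∀ t ∈ Θ, ∃ t' ∈ Θ, ∀ x ∈ congrGroup φ B H t' ⊤, ⁅w, x⁆ ∈ congrGroup φ B H t J := by
  rw [relClosure] at hw
  have hle := relClosure_le_closure (rootGen_subset_top (B := B) (H := H) J')
  induction hw using Subgroup.closure_induction with
  | mem w hw =>
    obtain ⟨g, hg, y, hy, rfl⟩ := hw
    intro t ht
    obtain ⟨t₁, ht₁, h₁⟩ := exists_conj_mem_congrGroup hs hH hden hg J t ht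
    obtain ⟨t₂, ht₂, h₂⟩ := exists_commutator_mem_congrGroup_of_mem_rootGen hs hH hdenJ hy t₁ ht₁
    obtain ⟨t₃, ht₃, h₃⟩ := exists_conj_mem_congrGroup hs hH hden (inv_mem hg) ⊤ t₂ ht₂
    refine ⟨t₃, ht₃, fun x hx => ?_⟩
    have := h₁ _ (h₂ _ (h₃ x hx))
    rwa [conjugate_commutatorElement, inv_inv,
      show g * (g⁻¹ * x * g) * g⁻¹ = x by group] at this
  | one => exact fun t ht => ⟨t, ht, fun x _ => by simp⟩
  | mul w v hw hv h₁ h₂ =>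
    intro t ht
    obtain ⟨t₁, ht₁, h₁⟩ := h₁ t ht
    obtain ⟨t₂, ht₂, h₃⟩ := exists_conj_mem_congrGroup hs hH hden (hle hw) J t ht
    obtain ⟨t₃, ht₃, h₂⟩ := h₂ t₂ ht₂
    refine ⟨t₁ * t₃, mul_mem ht₁ ht₃, fun x hx => ?_⟩
    rw [commutatorElement_mul_left_eq_conj_mul]
    exact mul_mem (h₃ _ (h₂ x (congrGroup_mul_le' _ _ _ hx)))
      (h₁ x (congrGroup_mul_le _ _ _ hx))
  | inv w hw h₁ =>
    intro t ht
    obtain ⟨t₂, ht₂, h₃⟩ := exists_conj_mem_congrGroup hs hH hden (inv_mem (hle hw)) J t ht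
    obtain ⟨t₁, ht₁, h₁⟩ := h₁ t₂ ht₂
    refine ⟨t₁, ht₁, fun x hx => ?_⟩
    rw [commutatorElement_inv_left, ← commutatorElement_inv]
    simpa using h₃ _ (inv_mem (h₁ x hx))

variable {Γ : D → ((D' × D' × M) ≃ₗ[D'] (D' × D' × M)) →* ((D' × D' × M) ≃ₗ[D'] (D' × D' × M))}
  {σ : D → D' → D'}

/-- The change of a generator under a substitution. Here `σ θ` stands for the substitution of `θ` for
the variable in scalars, and `Γ θ` for the substitution in automorphisms. -/
lemma exists_specialize_mem_congrGroup_of_mem_rootGen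
    (hs : ∀ x y, B x y = B y x) (hH : IsHyperbolicSet B H) {Θ : Submonoid D}
    (hΓ : ∀ θ ε, ∀ h ∈ H, ∀ c : D', Γ θ (elem B ε (c • h)) = elem B ε (σ θ c • h))
    {J : Ideal D} {J' : Ideal D'}
    (hσ : ∀ c ∈ J', ∃ u ∈ Θ, ∀ θ, ∃ d ∈ J, σ (u * θ) c - σ 0 c = φ (θ * d))
    {g : (D' × D' × M) ≃ₗ[D'] (D' × D' × M)} (hg : g ∈ rootGen B H J') :
    ∀ t ∈ Θ, ∃ t' ∈ Θ, ∀ θ, Γ (t' * θ) g * (Γ 0 g)⁻¹ ∈ congrGroup φ B H t J := by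
  obtain ⟨ε, h, hh, c, hc, rfl⟩ := hg
  intro t ht
  have h0 := hH.isotropic h hh
  obtain ⟨u, hu, hd⟩ := hσ c hc
  refine ⟨u * t, mul_mem hu ht, fun θ => ?_⟩
  obtain ⟨d, hd, e⟩ := hd (t * θ)
  rw [hΓ _ _ _ hh, hΓ _ _ _ hh, elem_inv _ (by simp [h0]),
    elem_mul hs _ (by simp [h0]) (by simp [h0]) (by simp [h0]), ← sub_eq_add_neg, ← sub_smul,
    mul_assoc, e, mul_assoc]
  exact elem_mem_congrGroup hh (J.mul_mem_left _ hd)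

/-- The elements which change only by a small element, up to their value at zero, under the
substitution for the variable of a multiple of a highly divisible element form a group. -/
lemma exists_specialize_mem_congrGroup_of_mem_closure
    (hs : ∀ x y, B x y = B y x) (hH : IsHyperbolicSet B H) {Θ : Submonoid D}
    (hden : ∀ c : D', ∃ u ∈ Θ, ∃ d, φ u * c = φ d) {J : Ideal D}
    {X : Set ((D' × D' × M) ≃ₗ[D'] (D' × D' × M))}
    (hX : ∀ g ∈ X, ∀ t ∈ Θ, ∃ t' ∈ Θ, ∀ θ, Γ (t' * θ) g * (Γ 0 g)⁻¹ ∈ congrGroup φ B H t J)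
    (hX0 : ∀ g ∈ X, Γ 0 g ∈ Subgroup.closure (rootGen B H ⊤))
    {g : (D' × D' × M) ≃ₗ[D'] (D' × D' × M)} (hg : g ∈ Subgroup.closure X) :
    ∀ t ∈ Θ, ∃ t' ∈ Θ, ∀ θ, Γ (t' * θ) g * (Γ 0 g)⁻¹ ∈ congrGroup φ B H t J := by
  have hΓ0 : Subgroup.closure X ≤ (Subgroup.closure (rootGen B H ⊤)).comap (Γ 0) :=
    (Subgroup.closure_le _).2 hX0
  induction hg using Subgroup.closure_induction with
  | mem g hg => exact hX g hg
  | one => exact fun t ht => ⟨t, ht, fun θ => by simp⟩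
  | mul g k hg hk h₁ h₂ =>
    intro t ht
    obtain ⟨t₁, ht₁, h₁⟩ := h₁ t ht
    obtain ⟨t₂, ht₂, h₃⟩ := exists_conj_mem_congrGroup hs hH hden (hΓ0 hg) J t ht
    obtain ⟨t₃, ht₃, h₂⟩ := h₂ t₂ ht₂
    refine ⟨t₁ * t₃, mul_mem ht₁ ht₃, fun θ => ?_⟩
    have := mul_mem (h₁ (t₃ * θ)) (h₃ _ (h₂ (t₁ * θ)))
    rw [show t₃ * (t₁ * θ) = t₁ * (t₃ * θ) by ring] at this
    rw [mul_assoc]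
    convert this using 1
    simp only [map_mul]
    group
  | inv g hg h₁ =>
    intro t ht
    obtain ⟨t₂, ht₂, h₃⟩ := exists_conj_mem_congrGroup hs hH hden (inv_mem (hΓ0 hg)) J t ht
    obtain ⟨t₁, ht₁, h₁⟩ := h₁ t₂ ht₂
    refine ⟨t₁, ht₁, fun θ => ?_⟩
    have := inv_mem (h₃ _ (h₁ θ))
    convert this using 1
    simp only [map_inv]
    group

/-- Substituting for the variable a multiple of a highly divisible element changes a relative
element, up to its value at zero, only by a small relative element. -/
lemma exists_specialize_mem_congrGroup
    (hs : ∀ x y, B x y = B y x) (hH : IsHyperbolicSet B H) {Θ : Submonoid D}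
    (hΓ : ∀ θ ε, ∀ h ∈ H, ∀ c : D', Γ θ (elem B ε (c • h)) = elem B ε (σ θ c • h))
    {J : Ideal D} {J' : Ideal D'}
    (hden : ∀ c : D', ∃ u ∈ Θ, ∃ d, φ u * c = φ d)
    (hdenJ : ∀ c ∈ J', ∃ u ∈ Θ, ∃ d ∈ J, φ u * c = φ d)
    (hσ : ∀ c, ∃ u ∈ Θ, ∀ θ, ∃ d, σ (u * θ) c - σ 0 c = φ (θ * d))
    (hσJ : ∀ c ∈ J', ∃ u ∈ Θ, ∀ θ, ∃ d ∈ J, σ (u * θ) c - σ 0 c = φ (θ * d))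
    (hσ0 : ∀ c ∈ J', σ 0 c ∈ J')
    {g : (D' × D' × M) ≃ₗ[D'] (D' × D' × M)}
    (hg : g ∈ relClosure (rootGen B H ⊤) (rootGen B H J')) :
    ∀ t ∈ Θ, ∃ t' ∈ Θ, ∀ θ, Γ (t' * θ) g * (Γ 0 g)⁻¹ ∈ congrGroup φ B H t J := by
  have hgen : ∀ g ∈ rootGen B H ⊤, Γ 0 g ∈ Subgroup.closure (rootGen B H ⊤) := by
    rintro _ ⟨ε, h, hh, c, -, rfl⟩
    exact Subgroup.subset_closure ⟨ε, h, hh, σ 0 c, Submodule.mem_top, (hΓ _ _ _ hh _).symm⟩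
  have hrel : ∀ g ∈ relClosure (rootGen B H ⊤) (rootGen B H J'),
      Γ 0 g ∈ relClosure (rootGen B H ⊤) (rootGen B H J') := by
    refine fun g hg => map_mem_relClosure (Γ 0) hgen ?_ hg
    rintro _ ⟨ε, h, hh, c, hc, rfl⟩
    exact subset_relClosure ⟨ε, h, hh, σ 0 c, hσ0 c hc, (hΓ _ _ _ hh _).symm⟩
  refine exists_specialize_mem_congrGroup_of_mem_closure hs hH hden ?_ ?_ hg
  · rintro _ ⟨k, hk, y, hy, rfl⟩ t ht
    have hk0 : Γ 0 k ∈ Subgroup.closure (rootGen B H ⊤) :=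
      (Subgroup.closure_le ((Subgroup.closure (rootGen B H ⊤)).comap (Γ 0))).2 hgen hk
    have hw := hrel _ (conj_mem_relClosure hk (subset_relClosure hy))
    obtain ⟨t₁, ht₁, h₁⟩ := exists_commutator_mem_congrGroup hs hH hden hdenJ hw t ht
    obtain ⟨t₂, ht₂, h₂⟩ := exists_specialize_mem_congrGroup_of_mem_closure (J := ⊤) hs hH hden
      (fun g hg => exists_specialize_mem_congrGroup_of_mem_rootGen hs hH hΓ
        (by simpa using hσ) hg) hgen hk (t * t₁) (mul_mem ht ht₁)
    obtain ⟨t₃, ht₃, h₃⟩ := exists_conj_mem_congrGroup hs hH hden hk0 J t ht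
    obtain ⟨t₄, ht₄, h₄⟩ := exists_specialize_mem_congrGroup_of_mem_rootGen hs hH hΓ hσJ hy t₃ ht₃
    refine ⟨t₂ * t₄, mul_mem ht₂ ht₄, fun θ => ?_⟩
    have h₂' := h₂ (t₄ * θ)
    have h₄' := h₃ _ (h₄ (t₂ * θ))
    rw [show t₄ * (t₂ * θ) = t₂ * (t₄ * θ) by ring] at h₄'
    -- The quotient is a conjugate of the quotient for `y` times a commutator.
    have := mul_mem (conj_mem_congrGroup (congrGroup_mul_le _ _ _ h₂') h₄')
      (inv_mem (h₁ _ (congrGroup_mul_le' _ _ _ h₂')))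
    rw [mul_assoc t₂]
    convert this using 1
    simp only [map_mul, map_inv, commutatorElement_def]
    group
  · rintro _ ⟨k, hk, y, hy, rfl⟩
    exact relClosure_le_closure (rootGen_subset_top J')
      (hrel _ (conj_mem_relClosure hk (subset_relClosure hy)))

end Congruence

/-! ### The elementary orthogonal groups -/

section ElementaryGroup

variable {A : Type*} [CommRing A] {M : Type*} [AddCommGroup M] [Module A M]
  {B : LinearMap.BilinForm A M}

/-- The elementary orthogonal transvections are the maps `elem B ε q` with `q` isotropic. -/
lemma mem_elementaryTransvections_iff (hs : ∀ x y, B x y = B y x) {J : Ideal A}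
    {t : (A × A × M) ≃ₗ[A] (A × A × M)} :
    t ∈ elementaryTransvections J B ↔
      ∃ ε, ∃ q ∈ J • (⊤ : Submodule A M), B q q = 0 ∧ elem B ε q = t := by
  constructor
  · rintro ⟨⟨u, v, hu, hv, huv, -, ht⟩, q, hq, h⟩
    have hiso : t ∈ orthogonalGroup (hypSum B) := by
      have hp : IsIsotropicPair (hypSum B) u v := ⟨hu, hv, huv, by rw [hypSum_symm hs, huv]⟩
      have : t = transvection (hypSum B) u v := by
        ext1 x
        rw [ht, transvection_apply hp]
      rw [this]
      exact transvection_mem_orthogonalGroup (hypSum_symm hs) hp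
    rcases h with h | h
    · have hq0 : B q q = 0 := by
        have := hiso (1, 0, 0) (1, 0, 0)
        rw [h] at this
        simpa [hypSum_apply] using this
      refine ⟨true, q, hq, hq0, ?_⟩
      ext1 ⟨a, b, p⟩
      rw [h, elem_true_apply hq0, hs p q]
    · have hq0 : B q q = 0 := by
        have := hiso (0, 1, 0) (0, 1, 0)
        rw [h] at this
        simpa [hypSum_apply] using this
      refine ⟨false, q, hq, hq0, ?_⟩
      ext1 ⟨a, b, p⟩
      rw [h, elem_false_apply hq0, hs p q]
  · rintro ⟨ε, q, hq, hq0, rfl⟩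
    have hp := isIsotropicPair_hypVec (B := B) hq0 ε
    refine ⟨⟨_, _, hp.1, hp.2.1, hp.2.2.1, Or.inl ?_, fun x => transvection_apply hp x⟩, q, hq, ?_⟩
    · cases ε
      · exact ⟨LinearMap.fst A A (A × M), rfl⟩
      · exact ⟨LinearMap.fst A A M ∘ₗ LinearMap.snd A A (A × M), rfl⟩
    · cases ε
      · exact Or.inr fun a b p => by rw [elem_false_apply hq0, hs p q]
      · exact Or.inl fun a b p => by rw [elem_true_apply hq0, hs p q]

lemma ETransRel_eq_relClosure (J : Ideal A) (B : LinearMap.BilinForm A M) :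
    ETransRel J B = relClosure (elementaryTransvections ⊤ B) (elementaryTransvections J B) := by
  have hJ : elementaryTransvections J B ⊆ elementaryTransvections ⊤ B := by
    rintro t ⟨ht, q, hq, h⟩
    exact ⟨ht, q, Submodule.smul_mono_left le_top hq, h⟩
  apply le_antisymm
  · rw [ETransRel, Subgroup.map_le_iff_le_comap]
    have hn : ((relClosure (elementaryTransvections ⊤ B) (elementaryTransvections J B)).comap
        (ETrans B).subtype).Normal :=
      ⟨fun _ hx g => conj_mem_relClosure g.2 hx⟩
    refine Subgroup.normalClosure_le_normal fun x hx => ?_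
    exact (Subgroup.closure_le _).2 (fun _ => subset_relClosure)
      (Subgroup.mem_subgroupOf.1 hx : (x : (A × A × M) ≃ₗ[A] (A × A × M)) ∈ ETransIdeal J B)
  · refine relClosure_le fun g hg y hy => ?_
    have hyT : y ∈ ETrans B := Subgroup.subset_closure (hJ hy)
    refine ⟨⟨g, hg⟩ * ⟨y, hyT⟩ * ⟨g, hg⟩⁻¹, ?_, rfl⟩
    refine Subgroup.normalClosure_normal.conj_mem _ (Subgroup.subset_normalClosure ?_) _
    exact Subgroup.mem_subgroupOf.2 (Subgroup.subset_closure hy)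

lemma apply_mem_of_mem_smul_top {J : Ideal A} {q : M} (hq : q ∈ J • (⊤ : Submodule A M))
    (f : M →ₗ[A] A) : f q ∈ J := by
  induction hq using Submodule.smul_induction_on' with
  | smul r hr x _ => exact f.map_smul r x ▸ J.mul_mem_right _ hr
  | add x _ y _ hx hy => exact f.map_add x y ▸ J.add_mem hx hy

end ElementaryGroup

/-! ### Hyperbolic bases -/

section HyperbolicBasis

variable {A : Type*} [CommRing A] {M : Type*} [AddCommGroup M] [Module A M]

/-- A hyperbolic basis `e i`, `f i` of a module with a symmetric bilinear form. -/
structure IsHyperbolicBasis (B : LinearMap.BilinForm A M) {ι : Type*} [Fintype ι] [DecidableEq ι]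
    (e f : ι → M) : Prop where
  ee : ∀ i j, B (e i) (e j) = 0
  ff : ∀ i j, B (f i) (f j) = 0
  ef : ∀ i j, B (e i) (f j) = if i = j then 1 else 0
  expand : ∀ x, x = ∑ i, B x (f i) • e i + ∑ i, B x (e i) • f i

variable {B : LinearMap.BilinForm A M} {ι : Type*} [Fintype ι] [DecidableEq ι] {e f : ι → M}

lemma IsHyperbolicBasis.isHyperbolicSet (h : IsHyperbolicBasis B e f)
    (hs : ∀ x y, B x y = B y x) [Nontrivial ι] :
    IsHyperbolicSet B (Set.range e ∪ Set.range f) := by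
  refine ⟨?_, ?_⟩
  · rintro _ (⟨i, rfl⟩ | ⟨i, rfl⟩)
    · exact h.ee i i
    · exact h.ff i i
  · have key : ∀ i : ι, ∃ j, i ≠ j := fun i => (exists_ne i).imp fun _ => Ne.symm
    have fe : ∀ i j, B (f i) (e j) = if j = i then 1 else 0 := fun i j => by rw [hs, h.ef]
    rintro _ (⟨i, rfl⟩ | ⟨i, rfl⟩) _ (⟨k, rfl⟩ | ⟨k, rfl⟩)
    · exact Or.inl (h.ee i k)
    · by_cases hik : i = k
      · subst hik
        obtain ⟨j, hj⟩ := key i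
        exact Or.inr ⟨by simp [h.ef], e j, Or.inl ⟨j, rfl⟩, f j, Or.inr ⟨j, rfl⟩,
          by simp [h.ef], h.ee _ _, by simp [h.ef, hj], by simp [fe, hj.symm], h.ff _ _⟩
      · exact Or.inl (by simp [h.ef, hik])
    · by_cases hik : k = i
      · subst hik
        obtain ⟨j, hj⟩ := key k
        exact Or.inr ⟨by simp [fe], e j, Or.inl ⟨j, rfl⟩, f j, Or.inr ⟨j, rfl⟩,
          by simp [h.ef], by simp [fe, hj.symm], h.ff _ _, h.ee _ _, by simp [h.ef, hj]⟩
      · exact Or.inl (by simp [fe, hik])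
    · exact Or.inl (h.ff i k)

/-- An elementary transvection with parameter in the span of pairwise orthogonal isotropic vectors
is a product of transvections with parameters multiples of these. -/
lemma elem_sum_mem (hs : ∀ x y, B x y = B y x) {v : ι → M} (hv : ∀ i j, B (v i) (v j) = 0)
    {H : Set M} (hvH : ∀ i, v i ∈ H) {J : Ideal A} {c : ι → A} (hc : ∀ i, c i ∈ J) (ε : Bool) :
    elem B ε (∑ i, c i • v i) ∈ Subgroup.closure (rootGen B H J) := by
  have orth : ∀ s t : Finset ι, B (∑ i ∈ s, c i • v i) (∑ i ∈ t, c i • v i) = 0 := by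
    intro s t
    simp [map_sum, LinearMap.sum_apply, hv]
  suffices h : ∀ s : Finset ι, elem B ε (∑ i ∈ s, c i • v i) ∈ Subgroup.closure (rootGen B H J) from
    h _
  intro s
  induction s using Finset.induction_on with
  | empty => simp [elem_zero]
  | insert i s hi ih =>
    rw [Finset.sum_insert hi, ← elem_mul hs ε (by simp [hv]) (orth s s)
      (by simpa using orth {i} s)]
    exact mul_mem (Subgroup.subset_closure ⟨ε, v i, hvH i, c i, hc i, rfl⟩) ih

/-- In the presence of a hyperbolic basis, the elementary group is generated by the transvections
whose parameters are multiples of basis vectors. An isotropic vector is the sum of its components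
in the two isotropic halves, and these are orthogonal to each other because `2` is invertible. -/
lemma IsHyperbolicBasis.elementaryTransvections_subset (h : IsHyperbolicBasis B e f)
    (hs : ∀ x y, B x y = B y x) (h2 : IsUnit (2 : A)) (J : Ideal A) :
    elementaryTransvections J B ⊆
      Subgroup.closure (rootGen B (Set.range e ∪ Set.range f) J) := by
  intro t ht
  obtain ⟨ε, q, hq, hq0, rfl⟩ := (mem_elementaryTransvections_iff hs).1 ht
  set x := ∑ i, B q (f i) • e i with hx
  set y := ∑ i, B q (e i) • f i with hy
  have hxx : B x x = 0 := by simp [hx, map_sum, LinearMap.sum_apply, h.ee]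
  have hyy : B y y = 0 := by simp [hy, map_sum, LinearMap.sum_apply, h.ff]
  have hxy : B x y = 0 := by
    rw [h.expand q, ← hx, ← hy] at hq0
    simp only [map_add, LinearMap.add_apply, hxx, hyy, hs y x] at hq0
    exact h2.mul_left_cancel (by linear_combination hq0)
  rw [h.expand q, ← hx, ← hy, ← elem_mul hs ε hxx hyy hxy]
  exact mul_mem
    (elem_sum_mem hs h.ee (fun i => Or.inl ⟨i, rfl⟩)
      (fun i => apply_mem_of_mem_smul_top hq (B.flip (f i))) ε)
    (elem_sum_mem hs h.ff (fun i => Or.inr ⟨i, rfl⟩)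
      (fun i => apply_mem_of_mem_smul_top hq (B.flip (e i))) ε)

lemma IsHyperbolicBasis.ETransRel_le (h : IsHyperbolicBasis B e f)
    (hs : ∀ x y, B x y = B y x) (h2 : IsUnit (2 : A)) (J : Ideal A) :
    ETransRel J B ≤ relClosure (rootGen B (Set.range e ∪ Set.range f) ⊤)
      (rootGen B (Set.range e ∪ Set.range f) J) := by
  rw [ETransRel_eq_relClosure]
  refine relClosure_le_of_le (h.elementaryTransvections_subset hs h2 ⊤)
    ((h.elementaryTransvections_subset hs h2 J).trans ?_)
  exact (Subgroup.closure_le _).2 fun _ => subset_relClosure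

end HyperbolicBasis

/-! ### Extension of scalars -/

section BaseChange

variable {R : Type*} [CommRing R] {P : Type*} [AddCommGroup P] [Module R P]
  {A : Type*} [CommRing A] [Algebra R A] {C : Type*} [CommRing C] [Algebra R C]
  {E : Type*} [CommRing E] [Algebra R E]

/-- The natural map `A ⊗ P → C ⊗ P` induced by a homomorphism `A → C` of `R`-algebras. -/
abbrev tensorMap (P : Type*) [AddCommGroup P] [Module R P] (φ : A →ₐ[R] C) :
    A ⊗[R] P →ₗ[R] C ⊗[R] P :=
  TensorProduct.map φ.toLinearMap LinearMap.id

lemma tensorMap_smul (φ : A →ₐ[R] C) (a : A) (x : A ⊗[R] P) :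
    tensorMap P φ (a • x) = φ a • tensorMap P φ x := by
  simpa [QMod.map] using congrArg (fun x => x.2.2) (QMod.map_smul φ a ((0, 0, x) : QMod A P))

lemma QMod.map_apply (φ : A →ₐ[R] C) (x : QMod (R := R) A P) :
    QMod.map φ x = (φ x.1, φ x.2.1, tensorMap P φ x.2.2) := rfl

lemma QMod.map_map (φ : A →ₐ[R] C) (ψ : C →ₐ[R] E) (x : QMod (R := R) A P) :
    QMod.map ψ (QMod.map φ x) = QMod.map (ψ.comp φ) x := by
  simp only [QMod.map_apply, AlgHom.comp_apply, Prod.mk.injEq, true_and]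
  rw [← LinearMap.comp_apply, ← TensorProduct.map_comp]
  rfl

lemma extendAut_map (φ : A →ₐ[R] C) (g : QMod (R := R) A P ≃ₗ[A] QMod (R := R) A P)
    (x : QMod (R := R) A P) : extendAut φ g (QMod.map φ x) = QMod.map φ (g x) :=
  extendEnd_map φ g.toLinearMap x

lemma extendAut_eq_iff (φ : A →ₐ[R] C) {g : QMod (R := R) A P ≃ₗ[A] QMod (R := R) A P}
    {h : QMod (R := R) C P ≃ₗ[C] QMod (R := R) C P} :
    extendAut φ g = h ↔ ∀ x, QMod.map φ (g x) = h (QMod.map φ x) := by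
  constructor
  · rintro rfl x
    rw [extendAut_map]
  · intro H
    refine LinearEquiv.toLinearMap_injective (QMod.hom_ext φ fun x => ?_)
    exact (extendAut_map φ g x).trans (H x)

/-- Extension of scalars, as a homomorphism between the groups of linear automorphisms. -/
def extendAutHom (φ : A →ₐ[R] C) :
    (QMod (R := R) A P ≃ₗ[A] QMod (R := R) A P) →* (QMod (R := R) C P ≃ₗ[C] QMod (R := R) C P) where
  toFun := extendAut φ
  map_one' := (extendAut_eq_iff φ).2 fun _ => rfl
  map_mul' g h := (extendAut_eq_iff φ).2 fun x => by
    simp only [LinearEquiv.mul_apply, extendAut_map]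

lemma extendAutHom_apply (φ : A →ₐ[R] C) (g : QMod (R := R) A P ≃ₗ[A] QMod (R := R) A P) :
    extendAutHom φ g = extendAut φ g := rfl

lemma extendAut_one (φ : A →ₐ[R] C) :
    extendAut φ (1 : QMod (R := R) A P ≃ₗ[A] QMod (R := R) A P) = 1 :=
  map_one (extendAutHom φ)

lemma extendAut_mul (φ : A →ₐ[R] C) (g h : QMod (R := R) A P ≃ₗ[A] QMod (R := R) A P) :
    extendAut φ (g * h) = extendAut φ g * extendAut φ h :=
  map_mul (extendAutHom φ) g h

lemma extendAut_inv (φ : A →ₐ[R] C) (g : QMod (R := R) A P ≃ₗ[A] QMod (R := R) A P) :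
    extendAut φ g⁻¹ = (extendAut φ g)⁻¹ :=
  map_inv (extendAutHom φ) g

lemma extendAut_extendAut (φ : A →ₐ[R] C) (ψ : C →ₐ[R] E)
    (g : QMod (R := R) A P ≃ₗ[A] QMod (R := R) A P) :
    extendAut ψ (extendAut φ g) = extendAut (ψ.comp φ) g := by
  refine ((extendAut_eq_iff _).2 fun x => ?_).symm
  rw [← QMod.map_map, ← QMod.map_map, extendAut_map, extendAut_map]

lemma extendAut_id (g : QMod (R := R) A P ≃ₗ[A] QMod (R := R) A P) :
    extendAut (AlgHom.id R A) g = g := by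
  refine (extendAut_eq_iff _).2 fun x => ?_
  have : ∀ y : QMod (R := R) A P, QMod.map (AlgHom.id R A) y = y := fun y => by
    rw [QMod.map_apply, tensorMap, AlgHom.toLinearMap_id, TensorProduct.map_id]
    rfl
  rw [this, this]

variable {B : LinearMap.BilinForm R P}

lemma baseChange_symm (hs : ∀ x y, B x y = B y x) (x y : A ⊗[R] P) :
    B.baseChange A x y = B.baseChange A y x := by
  induction x with
  | zero => simp
  | add u v hu hv => simp only [map_add, LinearMap.add_apply, hu, hv]
  | tmul a p =>
    induction y with
    | zero => simp
    | add u v hu hv => simp only [map_add, LinearMap.add_apply, hu, hv]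
    | tmul b q => simp [LinearMap.BilinForm.baseChange_tmul, hs p q, mul_comm a b]

lemma baseChange_tensorMap (φ : A →ₐ[R] C) (x y : A ⊗[R] P) :
    B.baseChange C (tensorMap P φ x) (tensorMap P φ y) = φ (B.baseChange A x y) := by
  induction x with
  | zero => simp
  | add u v hu hv => simp only [map_add, LinearMap.add_apply, hu, hv]
  | tmul a p =>
    induction y with
    | zero => simp
    | add u v hu hv => simp only [map_add, hu, hv]
    | tmul b q => simp [LinearMap.BilinForm.baseChange_tmul]

lemma extendAut_elem (φ : A →ₐ[R] C) (ε : Bool) {q : A ⊗[R] P} (hq : B.baseChange A q q = 0) :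
    extendAut φ (elem (B.baseChange A) ε q) = elem (B.baseChange C) ε (tensorMap P φ q) := by
  have hq' : B.baseChange C (tensorMap P φ q) (tensorMap P φ q) = 0 := by
    rw [baseChange_tensorMap, hq, map_zero]
  refine (extendAut_eq_iff φ).2 fun x => ?_
  cases ε
  · rw [elem_false_apply hq, elem_false_apply hq']
    simp only [QMod.map_apply, map_add, map_sub, tensorMap_smul, baseChange_tensorMap]
  · rw [elem_true_apply hq, elem_true_apply hq']
    simp only [QMod.map_apply, map_add, map_sub, tensorMap_smul, baseChange_tensorMap]

lemma tensorMap_mem_smul_top (φ : A →ₐ[R] C) {J : Ideal A} {q : A ⊗[R] P}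
    (hq : q ∈ J • (⊤ : Submodule A (A ⊗[R] P))) :
    tensorMap P φ q ∈ J.map φ • (⊤ : Submodule C (C ⊗[R] P)) := by
  induction hq using Submodule.smul_induction_on' with
  | smul r hr x _ =>
    rw [tensorMap_smul]
    exact Submodule.smul_mem_smul (Ideal.mem_map_of_mem φ hr) Submodule.mem_top
  | add x _ y _ hx hy => exact map_add (tensorMap P φ) x y ▸ Submodule.add_mem _ hx hy

/-- Extension of scalars maps the relative elementary group into the relative elementary group. -/
lemma extendAut_mem_ETransOver (hs : ∀ x y, B x y = B y x) (φ : A →ₐ[R] C) {I : Ideal R}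
    {g : QMod (R := R) A P ≃ₗ[A] QMod (R := R) A P} (hg : g ∈ ETransOver A I B) :
    extendAut φ g ∈ ETransOver C I B := by
  rw [ETransOver, ETransRel_eq_relClosure] at hg ⊢
  have key : ∀ J : Ideal A, ∀ t ∈ elementaryTransvections J (B.baseChange A),
      extendAut φ t ∈ elementaryTransvections (J.map φ) (B.baseChange C) := by
    intro J t ht
    obtain ⟨ε, q, hq, hq0, rfl⟩ := (mem_elementaryTransvections_iff (baseChange_symm hs)).1 ht
    exact (mem_elementaryTransvections_iff (baseChange_symm hs)).2
      ⟨ε, _, tensorMap_mem_smul_top φ hq, by rw [baseChange_tensorMap, hq0, map_zero],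
        (extendAut_elem φ ε hq0).symm⟩
  refine map_mem_relClosure (extendAutHom φ) (fun t ht => ?_) (fun t ht => ?_) hg
  · have := key ⊤ t ht
    rw [Ideal.map_top] at this
    exact Subgroup.subset_closure this
  · have := key _ t ht
    have e : (I.map (algebraMap R A)).map φ = I.map (algebraMap R C) := by
      rw [← φ.comp_algebraMap, ← Ideal.map_map]
      rfl
    exact subset_relClosure (e ▸ this)

end BaseChange

/-! ### Maps with denominators -/

section Denominators

variable {R : Type*} [CommRing R] {A A' : Type*} [CommRing A] [Algebra R A] [CommRing A']
  [Algebra R A']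

/-- The elements of the multiplicative set `S` of scalars serve as denominators for the map `j`:
every element of the target becomes integral, and every element of the kernel becomes zero, after
multiplication by an element of `S`. -/
structure HasDenominators (S : Submonoid R) (j : A →ₐ[R] A') : Prop where
  exists_smul_eq : ∀ c, ∃ s ∈ S, ∃ a, s • c = j a
  exists_smul_eq_zero : ∀ a, j a = 0 → ∃ s ∈ S, s • a = 0

variable {S : Submonoid R} {j : A →ₐ[R] A'}

lemma algHom_mem_map {C : Type*} [CommRing C] [Algebra R C] (ψ : A →ₐ[R] C) {I : Ideal R} {a : A}
    (ha : a ∈ I.map (algebraMap R A)) : ψ a ∈ I.map (algebraMap R C) := by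
  have := Ideal.mem_map_of_mem (ψ : A →+* C) ha
  rwa [Ideal.map_map, ψ.comp_algebraMap] at this

lemma HasDenominators.exists_smul_eq_mem (h : HasDenominators S j) {I : Ideal R} {c : A'}
    (hc : c ∈ I.map (algebraMap R A')) :
    ∃ s ∈ S, ∃ a ∈ I.map (algebraMap R A), s • c = j a := by
  rw [Ideal.map, ← Ideal.submodule_span_eq] at hc
  induction hc using Submodule.span_induction with
  | mem c hc =>
    obtain ⟨r, hr, rfl⟩ := hc
    exact ⟨1, one_mem _, algebraMap R A r, Ideal.mem_map_of_mem _ hr, by simp⟩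
  | zero => exact ⟨1, one_mem _, 0, zero_mem _, by simp⟩
  | add c c' _ _ h₁ h₂ =>
    obtain ⟨s, hs, a, ha, e⟩ := h₁
    obtain ⟨s', hs', a', ha', e'⟩ := h₂
    refine ⟨s * s', mul_mem hs hs', s' • a + s • a',
      add_mem (Submodule.smul_of_tower_mem _ _ ha) (Submodule.smul_of_tower_mem _ _ ha'), ?_⟩
    rw [map_add, map_smul, map_smul, ← e, ← e', smul_smul, smul_smul, smul_add, mul_comm s']
  | smul d c _ h₁ =>
    obtain ⟨s, hs, a, ha, e⟩ := h₁
    obtain ⟨s', hs', b, e'⟩ := h.exists_smul_eq d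
    refine ⟨s' * s, mul_mem hs' hs, b * a, Ideal.mul_mem_left _ _ ha, ?_⟩
    rw [map_mul, ← e, ← e', smul_eq_mul, smul_mul_smul_comm]

lemma HasDenominators.mapAlgHom (h : HasDenominators S j) :
    HasDenominators S (Polynomial.mapAlgHom j) := by
  constructor
  · intro c
    induction c using Polynomial.induction_on' with
    | add p q hp hq =>
      obtain ⟨s, hs, a, e⟩ := hp
      obtain ⟨s', hs', a', e'⟩ := hq
      refine ⟨s * s', mul_mem hs hs', s' • a + s • a', ?_⟩
      rw [map_add, map_smul, map_smul, ← e, ← e', smul_smul, smul_smul, smul_add, mul_comm s']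
    | monomial n c =>
      obtain ⟨s, hs, a, e⟩ := h.exists_smul_eq c
      exact ⟨s, hs, Polynomial.monomial n a, by simp [Polynomial.smul_monomial, e]⟩
  · intro a ha
    have h0 : ∀ n, ∃ s ∈ S, s • a.coeff n = 0 := fun n =>
      h.exists_smul_eq_zero _ (by simpa using congrArg (fun p => Polynomial.coeff p n) ha)
    choose s hs e using h0
    refine ⟨∏ n ∈ a.support, s n, prod_mem fun n _ => hs n, ?_⟩
    ext n
    by_cases hn : n ∈ a.support
    · obtain ⟨c, hc⟩ := Finset.dvd_prod_of_mem s hn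
      rw [Polynomial.coeff_smul, hc, mul_comm, mul_smul, e, smul_zero, Polynomial.coeff_zero]
    · simp [Polynomial.notMem_support_iff.1 hn]

end Denominators

/-! ### Substitution for the variable -/

section Substitution

variable {R : Type*} [CommRing R] {A A' : Type*} [CommRing A] [Algebra R A] [CommRing A']
  [Algebra R A']

/-- The substitution of `θ` for the variable. -/
def subst (R : Type*) [CommRing R] {A : Type*} [CommRing A] [Algebra R A] (θ : A[X]) :
    A[X] →ₐ[R] A[X] :=
  (Polynomial.aeval θ).restrictScalars R

@[simp]
lemma subst_X (θ : A[X]) : subst R θ Polynomial.X = θ := by simp [subst]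

@[simp]
lemma subst_C (θ : A[X]) (a : A) : subst R θ (Polynomial.C a) = Polynomial.C a := by
  simp [subst]

lemma algHom_ext_C_X {E : Type*} [CommRing E] [Algebra R E] {f g : A[X] →ₐ[R] E}
    (hC : ∀ a, f (Polynomial.C a) = g (Polynomial.C a)) (hX : f Polynomial.X = g Polynomial.X) :
    f = g :=
  AlgHom.coe_ringHom_injective (Polynomial.ringHom_ext hC hX)

lemma subst_comp_subst (θ η : A[X]) : (subst R η).comp (subst R θ) = subst R (subst R η θ) :=
  algHom_ext_C_X (by simp) (by simp)

lemma mapAlgHom_comp_subst (j : A →ₐ[R] A') (θ : A[X]) :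
    (Polynomial.mapAlgHom j).comp (subst R θ) =
      (subst R (Polynomial.mapAlgHom j θ)).comp (Polynomial.mapAlgHom j) :=
  algHom_ext_C_X (by simp) (by simp)

lemma subst_sub_subst_zero (θ c : A[X]) :
    subst R θ c - subst R 0 c = θ * subst R θ c.divX := by
  conv_lhs => rw [← Polynomial.divX_mul_X_add c]
  simp
  ring

lemma divX_mem_map {I : Ideal R} {c : A[X]} (hc : c ∈ I.map (algebraMap R A[X])) :
    c.divX ∈ I.map (algebraMap R A[X]) := by
  have e : I.map (algebraMap R A[X]) = (I.map (algebraMap R A)).map Polynomial.C := by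
    rw [Ideal.map_map]
    rfl
  rw [e, Ideal.mem_map_C_iff] at hc ⊢
  intro n
  rw [Polynomial.coeff_divX]
  exact hc _

/-- Under the substitution of `u θ`, where `u` is a denominator of all coefficients, a
polynomial changes by an integral multiple of `θ`, up to its value at zero. -/
lemma HasDenominators.exists_subst_sub_eq {S : Submonoid R} {j : A →ₐ[R] A'}
    (h : HasDenominators S j) {I : Ideal R} {c : A'[X]} (hc : c ∈ I.map (algebraMap R A'[X])) :
    ∃ u ∈ S.map (algebraMap R A[X]), ∀ θ : A[X], ∃ d ∈ I.map (algebraMap R A[X]),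
      subst R (Polynomial.mapAlgHom j (u * θ)) c - subst R (Polynomial.mapAlgHom j 0) c =
        Polynomial.mapAlgHom j (θ * d) := by
  obtain ⟨s, hs, a, ha, e⟩ := h.mapAlgHom.exists_smul_eq_mem (divX_mem_map hc)
  refine ⟨algebraMap R A[X] s, ⟨s, hs, rfl⟩, fun θ =>
    ⟨subst R (algebraMap R A[X] s * θ) a, algHom_mem_map _ ha, ?_⟩⟩
  have := DFunLike.congr_fun (mapAlgHom_comp_subst j (algebraMap R A[X] s * θ)) a
  rw [AlgHom.comp_apply, AlgHom.comp_apply, ← e, map_smul] at this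
  rw [map_zero, subst_sub_subst_zero, map_mul _ θ, this, map_mul, AlgHom.commutes,
    Algebra.smul_def]
  ring

/-- A polynomial which vanishes at zero and has image zero after the denominators are inverted
becomes zero after rescaling the variable. -/
lemma HasDenominators.exists_subst_eq_zero {S : Submonoid R} {j : A →ₐ[R] A'}
    (h : HasDenominators S j) {c : A[X]} (hc : Polynomial.mapAlgHom j c = 0)
    (hc0 : subst R 0 c = 0) : ∃ s ∈ S, subst R (s • Polynomial.X : A[X]) c = 0 := by
  have e : Polynomial.mapAlgHom j c.divX = 0 := by
    ext n
    have := congrArg (fun p => Polynomial.coeff p (n + 1)) hc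
    simpa using this
  obtain ⟨s, hs, e⟩ := h.mapAlgHom.exists_smul_eq_zero _ e
  refine ⟨s, hs, ?_⟩
  have := subst_sub_subst_zero (R := R) (s • Polynomial.X) c
  rw [hc0, sub_zero, smul_mul_assoc, ← mul_smul_comm, ← map_smul, e, map_zero, mul_zero] at this
  exact this

end Substitution

/-! ### Dual bases -/

section DualBasis

variable {R : Type*} [CommRing R] {P : Type*} [AddCommGroup P] [Module R P]
  {A : Type*} [CommRing A] [Algebra R A] {C : Type*} [CommRing C] [Algebra R C]

lemma exists_dual_basis (R P : Type*) [CommRing R] [AddCommGroup P] [Module R P]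
    [Module.Finite R P] [Module.Projective R P] :
    ∃ (n : ℕ) (l : Fin n → P →ₗ[R] R) (p : Fin n → P), ∀ x, x = ∑ k, l k x • p k := by
  obtain ⟨n, f, g, -, -, h⟩ := Module.Finite.exists_comp_eq_id_of_projective R P
  refine ⟨n, fun k => LinearMap.proj k ∘ₗ g, fun k => f (Pi.single k 1), fun x => ?_⟩
  have hx : f (g x) = x := LinearMap.congr_fun h x
  conv_lhs => rw [← hx, pi_eq_sum_univ (g x), map_sum]
  refine Finset.sum_congr rfl fun k _ => ?_
  rw [map_smul]
  congr 2
  ext i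
  simp [Pi.single_apply, eq_comm]

/-- The extension of scalars `A ⊗ P → A` of a linear functional on `P`. -/
def extendFunctional (A : Type*) [CommRing A] [Algebra R A] (l : P →ₗ[R] R) : A ⊗[R] P →ₗ[A] A :=
  LinearMap.liftBaseChange A (Algebra.linearMap R A ∘ₗ l)

lemma extendFunctional_tmul (l : P →ₗ[R] R) (a : A) (p : P) :
    extendFunctional A l (a ⊗ₜ p) = a * algebraMap R A (l p) := by
  simp [extendFunctional]

lemma extendFunctional_tensorMap (φ : A →ₐ[R] C) (l : P →ₗ[R] R) (x : A ⊗[R] P) :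
    extendFunctional C l (tensorMap P φ x) = φ (extendFunctional A l x) := by
  induction x with
  | zero => simp
  | add u v hu hv => simp only [map_add, hu, hv]
  | tmul a p => simp [extendFunctional_tmul]

lemma eq_sum_extendFunctional {n : ℕ} {l : Fin n → P →ₗ[R] R} {p : Fin n → P}
    (h : ∀ x, x = ∑ k, l k x • p k) (x : A ⊗[R] P) :
    x = ∑ k, extendFunctional A (l k) x • (1 : A) ⊗ₜ[R] p k := by
  induction x with
  | zero => simp
  | add u v hu hv =>
    simp only [map_add, add_smul, Finset.sum_add_distrib]
    rw [← hu, ← hv]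
  | tmul a q =>
    conv_lhs => rw [h q, TensorProduct.tmul_sum]
    refine Finset.sum_congr rfl fun k _ => ?_
    rw [extendFunctional_tmul, TensorProduct.smul_tmul', smul_eq_mul, mul_one,
      TensorProduct.tmul_smul, mul_comm, ← Algebra.smul_def, TensorProduct.smul_tmul']

end DualBasis

/-! ### Automorphisms which become trivial after rescaling -/

section Separation

variable {R : Type*} [CommRing R] {P : Type*} [AddCommGroup P] [Module R P]
  {A A' : Type*} [CommRing A] [Algebra R A] [CommRing A'] [Algebra R A']
  {S : Submonoid R} {j : A →ₐ[R] A'}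

lemma subst_smul_X_comp (s s' : R) :
    (subst R (s' • Polynomial.X : A[X])).comp (subst R (s • Polynomial.X : A[X])) =
      subst R ((s * s') • Polynomial.X : A[X]) := by
  rw [subst_comp_subst, map_smul, subst_X, smul_smul]

/-- Finitely many conditions on a scalar which are stable under multiples, and each of which is
satisfied by an element of `S`, have a common solution in `S`. -/
lemma exists_common_mem {κ : Type*} [Finite κ] {p : κ → R → Prop}
    (hp : ∀ k s s', p k s → p k (s * s')) (h : ∀ k, ∃ s ∈ S, p k s) : ∃ s ∈ S, ∀ k, p k s := by
  classical
  have := Fintype.ofFinite κ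
  choose s hs h using h
  refine ⟨∏ k, s k, prod_mem fun k _ => hs k, fun k => ?_⟩
  obtain ⟨c, hc⟩ := Finset.dvd_prod_of_mem s (Finset.mem_univ k)
  rw [hc]
  exact hp _ _ _ (h k)

lemma HasDenominators.exists_map_subst_eq_zero [Module.Finite R P] [Module.Projective R P]
    (h : HasDenominators S j) {z : QMod (R := R) A[X] P}
    (hz : QMod.map (Polynomial.mapAlgHom j) z = 0) (hz0 : QMod.map (subst R 0) z = 0) :
    ∃ s ∈ S, QMod.map (subst R (s • Polynomial.X : A[X])) z = 0 := by
  obtain ⟨n, l, p, hlp⟩ := exists_dual_basis R P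
  simp only [QMod.map_apply, Prod.mk_eq_zero] at hz hz0 ⊢
  have mono : ∀ (c : A[X]) (s s' : R), subst R (s • Polynomial.X : A[X]) c = 0 →
      subst R ((s * s') • Polynomial.X : A[X]) c = 0 := by
    intro c s s' hc
    rw [← subst_smul_X_comp, AlgHom.comp_apply, hc, map_zero]
  obtain ⟨s₁, hs₁, h₁⟩ := h.exists_subst_eq_zero hz.1 hz0.1
  obtain ⟨s₂, hs₂, h₂⟩ := h.exists_subst_eq_zero hz.2.1 hz0.2.1
  obtain ⟨s₃, hs₃, h₃⟩ := exists_common_mem (S := S)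
    (p := fun k s => subst R (s • Polynomial.X : A[X]) (extendFunctional A[X] (l k) z.2.2) = 0)
    (fun k => mono _) fun k => h.exists_subst_eq_zero
      (by rw [← extendFunctional_tensorMap, hz.2.2, map_zero])
      (by rw [← extendFunctional_tensorMap, hz0.2.2, map_zero])
  refine ⟨s₁ * s₂ * s₃, mul_mem (mul_mem hs₁ hs₂) hs₃, ?_, ?_, ?_⟩
  · rw [mul_assoc]
    exact mono _ _ _ h₁
  · rw [mul_comm s₁, mul_assoc]
    exact mono _ _ _ h₂
  · rw [eq_sum_extendFunctional hlp (tensorMap P _ z.2.2)]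
    refine Finset.sum_eq_zero fun k _ => ?_
    rw [extendFunctional_tensorMap, mul_comm _ s₃, mono _ _ _ (h₃ k), zero_smul]

/-- An automorphism which becomes trivial at zero, and also after the denominators are inverted,
becomes trivial after rescaling the variable. -/
lemma HasDenominators.exists_extendAut_subst_eq_one [Module.Finite R P] [Module.Projective R P]
    (h : HasDenominators S j) {g : QMod (R := R) A[X] P ≃ₗ[A[X]] QMod (R := R) A[X] P}
    (hg : extendAut (Polynomial.mapAlgHom j) g = 1) (hg0 : extendAut (subst R 0) g = 1) :
    ∃ s ∈ S, extendAut (subst R (s • Polynomial.X : A[X])) g = 1 := by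
  obtain ⟨n, v, hv⟩ := Module.Finite.exists_fin (R := R) (M := QMod (R := R) R P)
  let ι := QMod.map (P := P) (Algebra.ofId R A[X])
  rw [extendAut_eq_iff] at hg hg0
  obtain ⟨s, hs, e⟩ := exists_common_mem (S := S)
    (p := fun k s => QMod.map (subst R (s • Polynomial.X : A[X])) (g (ι (v k)) - ι (v k)) = 0)
    (fun k s s' hk => by rw [← subst_smul_X_comp, ← QMod.map_map, hk, map_zero])
    fun k => h.exists_map_subst_eq_zero
      (by rw [map_sub, hg, LinearEquiv.coe_one, id, sub_self])
      (by rw [map_sub, hg0, LinearEquiv.coe_one, id, sub_self])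
  refine ⟨s, hs, ?_⟩
  set ψ := subst R (s • Polynomial.X : A[X])
  have hι : ∀ w, QMod.map ψ (ι w) = ι w := fun w => by
    rw [QMod.map_map]
    congr 2
    exact Subsingleton.elim _ _
  refine LinearEquiv.toLinearMap_injective (QMod.hom_ext (Algebra.ofId R A[X]) fun w => ?_)
  change extendAut ψ g (ι w) = ι w
  have hw : w ∈ Submodule.span R (Set.range v) := hv ▸ Submodule.mem_top
  rw [← hι w, extendAut_map, hι w]
  refine LinearMap.eqOn_span (f := QMod.map ψ ∘ₗ (g.toLinearMap.restrictScalars R) ∘ₗ ι)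
    (g := ι) ?_ hw
  rintro _ ⟨k, rfl⟩
  have := e k
  rw [map_sub, hι, sub_eq_zero] at this
  exact this

end Separation

/-! ### The dilation principle -/

section Dilation

variable {R : Type*} [CommRing R] {P : Type*} [AddCommGroup P] [Module R P]
  {A A' : Type*} [CommRing A] [Algebra R A] [CommRing A'] [Algebra R A']
  {B : LinearMap.BilinForm R P} {ι : Type*} [Fintype ι] [DecidableEq ι]

lemma IsHyperbolicBasis.baseChange (φ : A →ₐ[R] A') {e f : ι → A ⊗[R] P}
    (h : IsHyperbolicBasis (B.baseChange A) e f) :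
    IsHyperbolicBasis (B.baseChange A') (fun i => tensorMap P φ (e i))
      (fun i => tensorMap P φ (f i)) := by
  refine ⟨fun i k => ?_, fun i k => ?_, fun i k => ?_, fun x => ?_⟩
  · rw [baseChange_tensorMap, h.ee, map_zero]
  · rw [baseChange_tensorMap, h.ff, map_zero]
  · rw [baseChange_tensorMap, h.ef]
    split_ifs <;> simp
  · induction x with
    | zero => simp
    | add u v hu hv =>
      simp only [map_add, LinearMap.add_apply, add_smul, Finset.sum_add_distrib]
      conv_lhs => rw [hu, hv]
      abel
    | tmul a p =>
      have e : a ⊗ₜ[R] p = a • tensorMap P φ (1 ⊗ₜ p) := by simp [TensorProduct.smul_tmul']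
      rw [e]
      conv_lhs => rw [h.expand (1 ⊗ₜ p)]
      simp only [map_add, map_sum, map_smul, LinearMap.smul_apply, baseChange_tensorMap,
        tensorMap_smul, smul_add, Finset.smul_sum, smul_eq_mul, mul_smul]

/-- The elements of a sufficiently small congruence subgroup are defined over the ring `A`. -/
lemma congrGroup_le_map (hs : ∀ x y, B x y = B y x) (φ : A →ₐ[R] A') {H : Set (A' ⊗[R] P)} {s : R}
    (hH : ∀ h ∈ H, ∃ p : P, B p p = 0 ∧ s • h = 1 ⊗ₜ p) (I : Ideal R) :
    congrGroup (φ : A →+* A') (B.baseChange A') H (algebraMap R A s) (I.map (algebraMap R A)) ≤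
      (ETransOver A I B).map (extendAutHom φ) := by
  have key : ∀ J : Ideal A, ∀ g ∈ congrGen (φ : A →+* A') (B.baseChange A') H (algebraMap R A s) J,
      ∃ g' ∈ elementaryTransvections J (B.baseChange A), extendAutHom φ g' = g := by
    rintro J _ ⟨ε, h, hh, r, hr, rfl⟩
    obtain ⟨p, hp, e⟩ := hH h hh
    have h0 : B.baseChange A (r • 1 ⊗ₜ p) (r • 1 ⊗ₜ p) = 0 := by
      simp [LinearMap.BilinForm.baseChange_tmul, hp]
    refine ⟨elem (B.baseChange A) ε (r • 1 ⊗ₜ p), (mem_elementaryTransvections_iff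
      (baseChange_symm hs)).2 ⟨ε, _, Submodule.smul_mem_smul hr Submodule.mem_top, h0, rfl⟩, ?_⟩
    rw [extendAutHom_apply, extendAut_elem φ ε h0, tensorMap_smul]
    congr 1
    have e' : tensorMap P φ (1 ⊗ₜ p) = s • h := by rw [e]; simp
    rw [e', mul_comm, map_mul, mul_smul]
    simp
  rw [ETransOver, ETransRel_eq_relClosure]
  have hcl : Subgroup.closure
      (congrGen (φ : A →+* A') (B.baseChange A') H (algebraMap R A s) ⊤) ≤
      (Subgroup.closure (elementaryTransvections ⊤ (B.baseChange A))).map (extendAutHom φ) := by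
    refine (Subgroup.closure_le _).2 fun g hg => ?_
    obtain ⟨g', hg', rfl⟩ := key ⊤ g hg
    exact ⟨g', Subgroup.subset_closure hg', rfl⟩
  refine relClosure_le fun g hg y hy => ?_
  obtain ⟨g', hg', rfl⟩ := hcl hg
  obtain ⟨y', hy', rfl⟩ := key _ y hy
  exact ⟨g' * y' * g'⁻¹, conj_mem_relClosure hg' (subset_relClosure hy'), by simp⟩

/-- The dilation principle: if an automorphism over `A[X]` which is trivial at zero becomes
elementary after denominators in `S` are allowed, then it becomes elementary over `A[X]` after
rescaling the variable by an element of `S`. -/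
theorem exists_extendAut_subst_mem_ETransOver [Module.Finite R P] [Module.Projective R P]
    [Nontrivial ι] (h2 : IsUnit (2 : R)) (hs : ∀ x y, B x y = B y x) {S : Submonoid R}
    {j : A →ₐ[R] A'} (h : HasDenominators S j) {e f : ι → A' ⊗[R] P}
    (hb : IsHyperbolicBasis (B.baseChange A') e f) {s : R} (hsS : s ∈ S)
    (hlift : ∀ v ∈ Set.range e ∪ Set.range f, ∃ p : P, B p p = 0 ∧ s • v = 1 ⊗ₜ p) {I : Ideal R}
    {g : QMod (R := R) A[X] P ≃ₗ[A[X]] QMod (R := R) A[X] P}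
    (hg : extendAut (Polynomial.mapAlgHom j) g ∈ ETransOver A'[X] I B)
    (hg0 : extendAut (subst R 0) g = 1) :
    ∃ s ∈ S, extendAut (subst R (s • Polynomial.X : A[X])) g ∈ ETransOver A[X] I B := by
  set φ := Polynomial.mapAlgHom j with hφ
  let c : A' →ₐ[R] A'[X] := (Polynomial.CAlgHom : A' →ₐ[A'] A'[X]).restrictScalars R
  have hb' := hb.baseChange c
  have hs' : ∀ x y, B.baseChange A'[X] x y = B.baseChange A'[X] y x := baseChange_symm hs
  have h2' : IsUnit (2 : A'[X]) := by
    have := h2.map (algebraMap R A'[X])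
    rwa [map_ofNat] at this
  have hH := hb'.isHyperbolicSet hs'
  set H := Set.range (fun i => tensorMap P c (e i)) ∪ Set.range (fun i => tensorMap P c (f i))
  have hHv : ∀ v ∈ H, ∃ w ∈ Set.range e ∪ Set.range f, tensorMap P c w = v := by
    rintro _ (⟨i, rfl⟩ | ⟨i, rfl⟩)
    · exact ⟨e i, Or.inl ⟨i, rfl⟩, rfl⟩
    · exact ⟨f i, Or.inr ⟨i, rfl⟩, rfl⟩
  have hlift' : ∀ v ∈ H, ∃ p : P, B p p = 0 ∧ s • v = 1 ⊗ₜ p := by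
    intro v hv
    obtain ⟨w, hw, rfl⟩ := hHv v hv
    obtain ⟨p, hp, hpw⟩ := hlift w hw
    exact ⟨p, hp, by rw [← map_smul, hpw]; simp⟩
  have hΓ : ∀ (θ : A[X]) (ε : Bool), ∀ v ∈ H, ∀ a : A'[X],
      extendAutHom (subst R (φ θ)) (elem (B.baseChange A'[X]) ε (a • v)) =
        elem (B.baseChange A'[X]) ε (subst R (φ θ) a • v) := by
    intro θ ε v hv a
    rw [extendAutHom_apply, extendAut_elem _ _ (by simp [hH.isotropic v hv]), tensorMap_smul]
    obtain ⟨w, -, rfl⟩ := hHv v hv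
    rw [← LinearMap.comp_apply (tensorMap P _), ← TensorProduct.map_comp]
    have : (subst R (φ θ)).toLinearMap ∘ₗ c.toLinearMap = c.toLinearMap := by
      ext a
      simp [c]
    rw [this, LinearMap.comp_id]
  have mem : ∀ {J : Ideal R}, ∀ a ∈ J.map (algebraMap R A'[X]),
      ∃ u ∈ S.map (algebraMap R A[X]), ∃ d ∈ J.map (algebraMap R A[X]), φ u * a = φ d := by
    intro J a ha
    obtain ⟨u, hu, d, hd, e⟩ := h.mapAlgHom.exists_smul_eq_mem ha
    exact ⟨_, ⟨u, hu, rfl⟩, d, hd, by rw [AlgHom.commutes, ← Algebra.smul_def, e]⟩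
  obtain ⟨_, ⟨s₁, hs₁, rfl⟩, h₁⟩ := exists_specialize_mem_congrGroup
    (φ := (φ : A[X] →+* A'[X])) (Θ := S.map (algebraMap R A[X]))
    (Γ := fun θ => extendAutHom (subst R (φ θ))) (σ := fun θ => subst R (φ θ))
    (J := I.map (algebraMap R A[X])) (J' := I.map (algebraMap R A'[X])) hs' hH hΓ
    (fun a => by
      obtain ⟨u, hu, d, -, e⟩ := mem (J := ⊤) a (by rw [Ideal.map_top]; trivial)
      exact ⟨u, hu, d, e⟩)
    mem
    (fun a => by
      obtain ⟨u, hu, e⟩ := h.exists_subst_sub_eq (I := ⊤) (c := a) (by rw [Ideal.map_top]; trivial)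
      exact ⟨u, hu, fun θ => (e θ).imp fun d hd => hd.2⟩)
    (fun a ha => h.exists_subst_sub_eq ha)
    (fun a ha => algHom_mem_map _ ha)
    (hb'.ETransRel_le hs' h2' _ hg) _ ⟨s, hsS, rfl⟩
  have h₁ := h₁ Polynomial.X
  have hsub : ∀ (θ : A[X]) (g : QMod (R := R) A[X] P ≃ₗ[A[X]] QMod (R := R) A[X] P),
      extendAut (subst R (φ θ)) (extendAut φ g) = extendAut φ (extendAut (subst R θ) g) := by
    intro θ g
    rw [extendAut_extendAut, extendAut_extendAut, mapAlgHom_comp_subst]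
  simp only [extendAutHom_apply, hsub, hg0] at h₁
  rw [extendAut_one, inv_one, mul_one, ← Algebra.smul_def] at h₁
  set g₁ := extendAut (subst R (s₁ • Polynomial.X : A[X])) g with hg₁
  obtain ⟨γ, hγ, e₁⟩ := congrGroup_le_map hs φ hlift' I h₁
  rw [extendAutHom_apply] at e₁
  have hg₁0 : extendAut (subst R 0) g₁ = 1 := by
    rw [hg₁, extendAut_extendAut, subst_comp_subst, map_smul, subst_X, smul_zero, hg0]
  have e₂ : extendAut φ (extendAut (subst R 0) γ) = 1 := by
    rw [← hsub, e₁, hsub, hg₁0, extendAut_one]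
  have e₃ : extendAut (subst R 0) (extendAut (subst R (0 : A[X])) γ) =
      extendAut (subst R 0) γ := by
    rw [extendAut_extendAut, subst_comp_subst, map_zero]
  -- The lift is normalized to be trivial at zero.
  set γ₁ := γ * (extendAut (subst R 0) γ)⁻¹ with hγ₁
  have hγ₁m : γ₁ ∈ ETransOver A[X] I B :=
    mul_mem hγ (inv_mem (extendAut_mem_ETransOver hs _ hγ))
  obtain ⟨s₂, hs₂, e₄⟩ := h.exists_extendAut_subst_eq_one (g := g₁ * γ₁⁻¹)
    (by
      rw [hγ₁, extendAut_mul, extendAut_inv, extendAut_mul, extendAut_inv, e₂, e₁, inv_one,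
        mul_one, mul_inv_cancel])
    (by
      rw [hγ₁, extendAut_mul, extendAut_inv, extendAut_mul, extendAut_inv, e₃, hg₁0,
        mul_inv_cancel, inv_one, mul_one])
  refine ⟨s₁ * s₂, mul_mem hs₁ hs₂, ?_⟩
  rw [← subst_smul_X_comp, ← extendAut_extendAut, ← hg₁]
  rw [extendAut_mul, extendAut_inv, mul_inv_eq_one] at e₄
  rw [e₄]
  exact extendAut_mem_ETransOver hs _ hγ₁m

end Dilation

/-! ### Split forms over local rings -/

section Local

/-- A split form over a local ring has a hyperbolic basis: a basis of the totally isotropic summand,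
and the vectors which represent the dual functionals, corrected so as to be isotropic. -/
lemma IsSplit.exists_isHyperbolicBasis {L : Type*} [CommRing L] [IsLocalRing L] {M : Type*}
    [AddCommGroup M] [Module L M] [Module.Finite L M] [Module.Projective L M]
    {B : LinearMap.BilinForm L M} (h2 : IsUnit (2 : L)) (hs : ∀ x y, B x y = B y x)
    (hd : ∀ l : M →ₗ[L] L, ∃ x, ∀ y, B x y = l y) (h : IsSplit B) :
    ∃ (n : ℕ) (e f : Fin n → M), IsHyperbolicBasis B e f := by
  obtain ⟨N, ⟨N', hN'⟩, hN⟩ := h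
  have hproj : N.projectionOnto N' hN' ∘ₗ N.subtype = LinearMap.id :=
    LinearMap.ext fun x => Submodule.projectionOnto_apply_left hN' x
  have : Module.Finite L N := Module.Finite.of_surjective (N.projectionOnto N' hN') fun x =>
    ⟨x, LinearMap.congr_fun hproj x⟩
  have : Module.Projective L N := Module.Projective.of_split _ _ hproj
  have : Module.Free L N := Module.free_of_flat_of_isLocalRing
  let b := Module.finBasis L N
  have hbN : ∀ i k, B (b i) (b k) = 0 := fun i k => (hN _).1 (b i).2 _ (b k).2
  choose x hx using fun i => hd (b.coord i ∘ₗ N.projectionOnto N' hN')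
  have hxb : ∀ i k, B (x i) (b k) = if i = k then 1 else 0 := fun i k => by
    rw [hx, LinearMap.comp_apply, Submodule.projectionOnto_apply_left, Module.Basis.coord_apply,
      Module.Basis.repr_self, Finsupp.single_apply]
    simp [eq_comm]
  obtain ⟨c, hc⟩ := h2.exists_right_inv
  -- `c = 1 / 2`, so the products of the corrected vectors `f i` vanish.
  let f : Fin (Module.finrank L N) → M := fun i => x i - c • ∑ k, B (x i) (x k) • (b k : M)
  have hfb : ∀ i k, B (f i) (b k) = if i = k then 1 else 0 := fun i k => by
    simp [f, LinearMap.sub_apply, LinearMap.sum_apply, hbN, hxb, map_sub, map_sum]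
  have hff : ∀ i k, B (f i) (f k) = 0 := fun i k => by
    have e1 : B (f i) (f k) = B (f i) (x k) - c * B (x k) (x i) := by
      conv_lhs => rw [show f k = x k - c • ∑ l, B (x k) (x l) • (b l : M) from rfl]
      simp [map_sub, map_sum, hfb]
    have e2 : B (f i) (x k) = B (x i) (x k) - c * B (x i) (x k) := by
      simp [f, LinearMap.sub_apply, LinearMap.sum_apply, map_sub, map_sum, hs (b _) (x k), hxb]
    rw [e1, e2, hs (x k)]
    linear_combination (-B (x i) (x k)) * hc
  refine ⟨_, fun i => (b i : M), f, hbN, hff, fun i k => by rw [hs, hfb]; simp [eq_comm],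
    fun y => ?_⟩
  -- The error term of the expansion is orthogonal to `N`, hence in `N`, and to all `f i`.
  set z := y - (∑ i, B y (f i) • (b i : M) + ∑ i, B y (b i) • f i) with hz
  have hzb : ∀ k, B z (b k) = 0 := fun k => by
    simp [hz, LinearMap.sub_apply, LinearMap.add_apply, LinearMap.sum_apply, map_sub, map_add,
      map_sum, hbN, hfb]
  have hzf : ∀ k, B z (f k) = 0 := fun k => by
    simp [hz, LinearMap.sub_apply, LinearMap.add_apply, LinearMap.sum_apply, map_sub, map_add,
      map_sum, hff, hs (b _) (f k), hfb]
  have hzN : z ∈ N := by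
    refine (hN z).2 fun w hw => ?_
    have := congrArg (Subtype.val) (b.sum_repr ⟨w, hw⟩)
    simp only [AddSubmonoidClass.coe_finsetSum, SetLike.val_smul] at this
    rw [← this]
    simp [map_sum, hzb]
  have hz0 : z = 0 := by
    have e : z = ∑ i, b.repr ⟨z, hzN⟩ i • (b i : M) := by
      have := congrArg (Subtype.val) (b.sum_repr ⟨z, hzN⟩)
      simpa only [AddSubmonoidClass.coe_finsetSum, SetLike.val_smul] using this.symm
    have hr : ∀ k, b.repr ⟨z, hzN⟩ k = 0 := fun k => by
      have := hzf k
      rw [e] at this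
      simpa [LinearMap.sum_apply, map_sum, hs (b _) (f k), hfb] using this
    rw [e]
    simp [hr]
  exact sub_eq_zero.1 hz0

variable {R : Type*} [CommRing R] {P : Type*} [AddCommGroup P] [Module R P]
  {B : LinearMap.BilinForm R P}

/-- The extension of scalars of a non-degenerate form still represents every functional. -/
lemma exists_baseChange_eq [Module.Finite R P] [Module.Projective R P]
    (hB : Function.Surjective fun x : P => (B x : P →ₗ[R] R)) {L : Type*} [CommRing L] [Algebra R L]
    (l : L ⊗[R] P →ₗ[L] L) : ∃ x, ∀ y, B.baseChange L x y = l y := by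
  obtain ⟨n, d, p, hdp⟩ := exists_dual_basis R P
  choose b hb using fun k => hB (d k)
  refine ⟨∑ k, l (1 ⊗ₜ p k) ⊗ₜ b k, fun y => ?_⟩
  conv_rhs => rw [eq_sum_extendFunctional hdp y]
  simp only [map_sum, map_smul, LinearMap.sum_apply, smul_eq_mul]
  refine Finset.sum_congr rfl fun k _ => ?_
  induction y with
  | zero => simp
  | add u v hu hv => simp only [map_add, hu, hv, add_mul]
  | tmul a q =>
    have := LinearMap.congr_fun (hb k) q
    simp only at this
    rw [LinearMap.BilinForm.baseChange_tmul, extendFunctional_tmul, ← this, Algebra.smul_def]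
    ring

lemma hasDenominators_localization (m : Ideal R) [m.IsPrime] :
    HasDenominators m.primeCompl (Algebra.ofId R (Localization.AtPrime m)) := by
  constructor
  · intro c
    obtain ⟨⟨a, s⟩, h⟩ := IsLocalization.surj m.primeCompl c
    exact ⟨s, s.2, a, by rw [Algebra.smul_def, mul_comm, h]; rfl⟩
  · intro a ha
    obtain ⟨s, h⟩ := (IsLocalization.map_eq_zero_iff m.primeCompl (Localization.AtPrime m) a).1 ha
    exact ⟨s, s.2, h⟩

lemma HasDenominators.exists_smul_eq_tmul {S : Submonoid R} {L : Type*} [CommRing L] [Algebra R L]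
    (h : HasDenominators S (Algebra.ofId R L)) (v : L ⊗[R] P) :
    ∃ s ∈ S, ∃ p : P, s • v = 1 ⊗ₜ p := by
  induction v with
  | zero => exact ⟨1, one_mem _, 0, by simp⟩
  | add u v hu hv =>
    obtain ⟨s, hs, p, e⟩ := hu
    obtain ⟨s', hs', p', e'⟩ := hv
    refine ⟨s * s', mul_mem hs hs', s' • p + s • p', ?_⟩
    rw [TensorProduct.tmul_add, TensorProduct.tmul_smul, TensorProduct.tmul_smul, ← e, ← e',
      smul_smul, smul_smul, smul_add, mul_comm s']
  | tmul a p =>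
    obtain ⟨s, hs, r, e⟩ := h.exists_smul_eq a
    refine ⟨s, hs, r • p, ?_⟩
    rw [TensorProduct.smul_tmul', e, TensorProduct.tmul_smul, TensorProduct.smul_tmul',
      Algebra.smul_def, mul_one]
    rfl

/-- A multiple of an isotropic vector over a localization comes from an isotropic vector. -/
lemma HasDenominators.exists_smul_eq_tmul_isotropic {S : Submonoid R} {L : Type*} [CommRing L]
    [Algebra R L] (h : HasDenominators S (Algebra.ofId R L)) {v : L ⊗[R] P}
    (hv : B.baseChange L v v = 0) : ∃ s ∈ S, ∃ p : P, B p p = 0 ∧ s • v = 1 ⊗ₜ p := by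
  obtain ⟨s, hs, p, e⟩ := h.exists_smul_eq_tmul v
  have e0 : B.baseChange L (s • v) (s • v) = 0 := by
    rw [← algebraMap_smul L s v]
    simp [hv]
  rw [e, LinearMap.BilinForm.baseChange_tmul] at e0
  obtain ⟨s', hs', e'⟩ := h.exists_smul_eq_zero (B p p) (by
    simpa [Algebra.smul_def] using e0)
  refine ⟨s * s', mul_mem hs hs', s' • p, ?_, ?_⟩
  · simp only [map_smul, LinearMap.smul_apply, e', smul_zero]
  · rw [TensorProduct.tmul_smul, ← e, smul_smul, mul_comm]

/-- The rank of a module with a hyperbolic basis of `2 k` vectors over a nontrivial ring is at most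
`2 k`. -/
lemma IsHyperbolicBasis.finrank_le {L : Type*} [CommRing L] [Nontrivial L] {M : Type*}
    [AddCommGroup M] [Module L M] {B : LinearMap.BilinForm L M} {k : ℕ} {e f : Fin k → M}
    (h : IsHyperbolicBasis B e f) : Module.finrank L M ≤ k + k := by
  have hspan : Submodule.span L (Set.range (Sum.elim e f)) = ⊤ := by
    refine eq_top_iff.2 fun x _ => ?_
    rw [h.expand x]
    refine add_mem (sum_mem fun i _ => ?_) (sum_mem fun i _ => ?_)
    · exact Submodule.smul_mem _ _ (Submodule.subset_span ⟨Sum.inl i, rfl⟩)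
    · exact Submodule.smul_mem _ _ (Submodule.subset_span ⟨Sum.inr i, rfl⟩)
  have := finrank_range_le_card (R := L) (Sum.elim e f)
  rw [Set.finrank, hspan, finrank_top] at this
  simpa using this

end Local

/-! ### Patching -/

section Patching

variable {R : Type*} [CommRing R] {P : Type*} [AddCommGroup P] [Module R P]
  {B : LinearMap.BilinForm R P}

/-- The specialization `α(θ)` of an automorphism `α(X)`. -/
def evalAut {C : Type*} [CommRing C] [Algebra R C] (θ : C)
    (α : QMod (R := R) R[X] P ≃ₗ[R[X]] QMod (R := R) R[X] P) :
    QMod (R := R) C P ≃ₗ[C] QMod (R := R) C P :=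
  extendAut (Polynomial.aeval θ) α

lemma extendAut_evalAut {C E : Type*} [CommRing C] [Algebra R C] [CommRing E] [Algebra R E]
    (ψ : C →ₐ[R] E) (θ : C) (α : QMod (R := R) R[X] P ≃ₗ[R[X]] QMod (R := R) R[X] P) :
    extendAut ψ (evalAut θ α) = evalAut (ψ θ) α := by
  rw [evalAut, extendAut_extendAut, evalAut]
  congr 1
  exact Polynomial.algHom_ext (by simp)

lemma extendAut_evalAut_mul_inv {C E : Type*} [CommRing C] [Algebra R C] [CommRing E] [Algebra R E]
    (ψ : C →ₐ[R] E) (θ η : C) (α : QMod (R := R) R[X] P ≃ₗ[R[X]] QMod (R := R) R[X] P) :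
    extendAut ψ (evalAut θ α * (evalAut η α)⁻¹) =
      evalAut (ψ θ) α * (evalAut (ψ η) α)⁻¹ := by
  rw [extendAut_mul, extendAut_inv, extendAut_evalAut, extendAut_evalAut]

/-- The Quillen ideal of `α(X)`: the scalars `c` such that changing the argument of `α` by a
multiple of `c` changes the value of `α` by an elementary automorphism. -/
def quillenIdeal (I : Ideal R) (B : LinearMap.BilinForm R P)
    (α : QMod (R := R) R[X] P ≃ₗ[R[X]] QMod (R := R) R[X] P) : Ideal R where
  carrier := {c | ∀ f d : R[X], evalAut (f + c • d) α * (evalAut f α)⁻¹ ∈ ETransOver R[X] I B}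
  zero_mem' f d := by simp
  add_mem' {c c'} hc hc' f d := by
    have := mul_mem (hc' (f + c • d) d) (hc f d)
    simpa [add_smul, add_assoc] using this
  smul_mem' r c hc f d := by
    have := hc f (r • d)
    rwa [smul_smul, mul_comm] at this

lemma evalAut_X (α : QMod (R := R) R[X] P ≃ₗ[R[X]] QMod (R := R) R[X] P) :
    evalAut (Polynomial.X : R[X]) α = α := by
  rw [evalAut, Polynomial.aeval_X_left, extendAut_id]

lemma mem_ETransOver_of_quillenIdeal_eq_top {I : Ideal R}
    {α : QMod (R := R) R[X] P ≃ₗ[R[X]] QMod (R := R) R[X] P} (hα0 : evalZero α = 1)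
    (h : quillenIdeal I B α = ⊤) : α ∈ ETransOver R[X] I B := by
  have h0 : evalAut (0 : R[X]) α = 1 := by
    rw [← map_zero (Algebra.ofId R R[X]), ← extendAut_evalAut]
    change extendAut _ (evalZero α) = 1
    rw [hα0, extendAut_one]
  have := (h ▸ Submodule.mem_top : (1 : R) ∈ quillenIdeal I B α) 0 Polynomial.X
  simpa [h0, evalAut_X] using this

/-- If `α(X)` is elementary over `L[X]`, then so are its values in `L`-algebras. -/
lemma evalAut_mem_ETransOver (hs : ∀ x y, B x y = B y x) {L C : Type*} [CommRing L] [Algebra R L]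
    [CommRing C] [Algebra R C] [Algebra L C] [IsScalarTower R L C] {I : Ideal R}
    {α : QMod (R := R) R[X] P ≃ₗ[R[X]] QMod (R := R) R[X] P}
    (h : extendAut (Polynomial.mapAlgHom (Algebra.ofId R L)) α ∈ ETransOver L[X] I B) (θ : C) :
    evalAut θ α ∈ ETransOver C I B := by
  have := extendAut_mem_ETransOver hs ((Polynomial.aeval θ : L[X] →ₐ[L] C).restrictScalars R) h
  rw [extendAut_extendAut] at this
  convert this using 1
  rw [evalAut]
  congr 1
  exact Polynomial.algHom_ext (by simp)

/-- The Quillen ideal is not contained in a maximal ideal at which `α` is elementary: apply the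
dilation principle to `α(X + Y) α(X)⁻¹`, as an automorphism which depends on `Y`. -/
lemma not_quillenIdeal_le (h2 : IsUnit (2 : R)) {I : Ideal R}
    (hB : IsOrthogonalModule B) {n : ℕ} (hn : 2 ≤ n)
    (hrank : ∀ p : PrimeSpectrum R, Module.rankAtStalk (R := R) P p = 2 * n)
    (hsplit : IsLocallySplit B) {α : QMod (R := R) R[X] P ≃ₗ[R[X]] QMod (R := R) R[X] P}
    (m : Ideal R) [m.IsMaximal]
    (hloc : localize m α ∈ ETransOver (Localization.AtPrime m)[X] I B) :
    ¬ quillenIdeal I B α ≤ m := by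
  have := hB.finite
  have := hB.projective
  let L := Localization.AtPrime m
  have hL := hasDenominators_localization m
  obtain ⟨k, e, f, hef⟩ := (hsplit m).exists_isHyperbolicBasis
    (by have := h2.map (algebraMap R L); rwa [map_ofNat] at this) (baseChange_symm hB.symm)
    (exists_baseChange_eq hB.nondegenerate.2)
  -- The rank is at least `4`, so there are two hyperbolic pairs.
  have hk : 2 ≤ k := by
    have h1 : Module.finrank L (L ⊗[R] P) = 2 * n :=
      (Module.rankAtStalk_eq_finrank_tensorProduct ⟨m, inferInstance⟩).symm.trans (hrank _)
    have h3 := h1.symm.le.trans hef.finrank_le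
    omega
  have : Nontrivial (Fin k) := Fin.nontrivial_iff_two_le.2 hk
  obtain ⟨s, hs, hlift⟩ := exists_common_mem (S := m.primeCompl)
    (p := fun i s => ∃ p : P, B p p = 0 ∧ s • Sum.elim e f i = 1 ⊗ₜ p)
    (fun i s s' ⟨p, hp, hsp⟩ => ⟨s' • p, by simp [hp], by
      rw [TensorProduct.tmul_smul, ← hsp, smul_smul, mul_comm]⟩)
    (fun i => hL.exists_smul_eq_tmul_isotropic (by
      rcases i with i | i
      · exact hef.ee i i
      · exact hef.ff i i))
  let c : L →ₐ[R] L[X] := (Polynomial.CAlgHom : L →ₐ[L] L[X]).restrictScalars R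
  have hlift' : ∀ v ∈ Set.range (fun i => tensorMap P c (e i)) ∪
      Set.range (fun i => tensorMap P c (f i)), ∃ p : P, B p p = 0 ∧ s • v = 1 ⊗ₜ p := by
    have key : ∀ i, ∃ p : P, B p p = 0 ∧ s • tensorMap P c (Sum.elim e f i) = 1 ⊗ₜ p := by
      intro i
      obtain ⟨p, hp, hsp⟩ := hlift i
      exact ⟨p, hp, by rw [← map_smul, hsp]; simp⟩
    rintro _ (⟨i, rfl⟩ | ⟨i, rfl⟩)
    · exact key (Sum.inl i)
    · exact key (Sum.inr i)
  have hX : ∀ θ : L[X][X], evalAut θ α ∈ ETransOver L[X][X] I B :=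
    evalAut_mem_ETransOver hB.symm hloc
  let x : R[X][X] := Polynomial.C Polynomial.X
  obtain ⟨t, ht, hmem⟩ := exists_extendAut_subst_mem_ETransOver h2 hB.symm hL.mapAlgHom
    (hef.baseChange c) hs hlift' (I := I)
    (g := evalAut (x + Polynomial.X) α * (evalAut x α)⁻¹)
    (by
      rw [extendAut_evalAut_mul_inv]
      exact mul_mem (hX _) (inv_mem (hX _)))
    (by
      rw [extendAut_evalAut_mul_inv]
      simp [x])
  refine fun hle => ht (hle fun f d => ?_)
  obtain ⟨ψ, hψx, hψX⟩ : ∃ ψ : R[X][X] →ₐ[R] R[X], ψ x = f ∧ ψ Polynomial.X = d :=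
    ⟨((Polynomial.aeval d).restrictScalars R).comp
      (Polynomial.mapAlgHom (Polynomial.aeval f : R[X] →ₐ[R] R[X])), by simp [x], by simp⟩
  have := extendAut_mem_ETransOver hB.symm ψ hmem
  rw [extendAut_evalAut_mul_inv, extendAut_evalAut_mul_inv, map_add, subst_X, subst_C, map_add,
    map_smul, hψX] at this
  rwa [hψx] at this

end Patching

end OrthTrans

end

theorem mainTheorem2 {R : Type*} [CommRing R] {P : Type*} [AddCommGroup P] [Module R P]
    (h2 : IsUnit (2 : R)) (I : Ideal R)
    (B : LinearMap.BilinForm R P) (hB : OrthTrans.IsOrthogonalModule B)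
    (n : ℕ) (hn : 2 ≤ n)
    (hrank : ∀ p : PrimeSpectrum R, Module.rankAtStalk (R := R) P p = 2 * n)
    (hsplit : OrthTrans.IsLocallySplit B)
    (α : OrthTrans.QMod (R := R) (Polynomial R) P ≃ₗ[Polynomial R]
      OrthTrans.QMod (R := R) (Polynomial R) P)
    (hα : α ∈ OrthTrans.orthogonalGroup (OrthTrans.hypSum (B.baseChange (Polynomial R))))
    (hα0 : OrthTrans.evalZero α = 1)
    (hloc : ∀ (m : Ideal R) [m.IsMaximal],
      OrthTrans.localize m α ∈
        OrthTrans.ETransOver (Polynomial (Localization.AtPrime m)) I B) :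
    α ∈ OrthTrans.ETransOver (Polynomial R) I B := by
  refine OrthTrans.mem_ETransOver_of_quillenIdeal_eq_top hα0 ?_
  by_contra hne
  obtain ⟨m, hm, hle⟩ := Ideal.exists_le_maximal _ hne
  exact OrthTrans.not_quillenIdeal_le h2 hB hn hrank hsplit m (hloc m) hle
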